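/- For integers $1\le k\le d$ let $\mathcal P_{k,d,2}$ be the class of all pairs $(\theta,P)$ such that $\theta\in\mathbb R^d$ satisfies $\|\theta\|_1\le 1$ and $\|\theta\|_0\le k$, and $P$ is the law of $(x,y)$ with $y=\langle\theta,x\rangle+\zeta$, where $x$ is uniform on $\{-1,+1\}^d$, $|\zeta|\le 2$ almost surely and $\mathbb E[\zeta\mid x]=0$. The corresponding data universe is $\mathcal D=\{-1,+1\}^d\times[-3,3]$. A sequentially interactive algorithm $\mathcal A$ on $n$ users with data $v_1,\dots,v_n$ works as follows: for $i=1,\dots,n$, user $i$ sends a message $Z_i$ (in an arbitrary measurable space) drawn from $Q_i(\cdot\mid v_i,Z_1,\dots,Z_{i-1})$, where $Q_i$ is a Markov kernel; the output $\mathcal A(D)\in\mathbb R^d$ is a possibly randomized measurable function of $(Z_1,\dots,Z_n)$. It is $\epsilon$-sequentially interactive LDP if $$Q_i(S\mid v,z_{1:i-1})\le e^{\epsilon}\,Q_i(S\mid v',z_{1:i-1})$$ for all $i\le n$, all $z_{1:i-1}$, all $v,v'\in\mathcal D$ and all measurable $S$. There is a universal constant $c>0$ such that for all integers $1\le k\le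 d$ and $n\ge 0$, all $0<\epsilon\le 1$, and every $\epsilon$-sequentially interactive LDP algorithm $\mathcal A$ on $n$ users, the following hold. 1. If $0<\nu\le\frac{1}{4\sqrt{2k}}$ and $\mathbb E_{\mathcal A,\,D\sim P^{\otimes n}}\big[\|\mathcal A(D)-\theta\|_2\big]\le\nu$ for every $(\theta,P)\in\mathcal P_{k,d,2}$, then $$n\ \ge\ c\,\frac{dk}{\nu^2\epsilon^2}.$$ 2. If $n\ge 1$, there is $(\theta,P)\in\mathcal P_{k,d,2}$ with $$\mathbb E_{\mathcal A,\,D\sim P^{\otimes n}}\big[\|\mathcal A(D)-\theta\|_2\big]\ \ge\ \min\Big\{c\sqrt{\frac{dk}{n\epsilon^2}},\ \frac{1}{4\sqrt{2k}}\Big\}.$$ -/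

import Mathlib

open MeasureTheory ProbabilityTheory

universe u

noncomputable section

/-! ### The class of sparse linear regression models -/

/-- The hypercube `{-1, +1}^d` inside `ℝ^d`. -/
def signCube (d : ℕ) : Set (EuclideanSpace ℝ (Fin d)) :=
  {x | ∀ i, x i = 1 ∨ x i = -1}

/-- `IsNoiseLaw d C μ`: the measure `μ` is the joint law of a pair `(x, ζ)`, where `x` is uniform on
`{-1, +1}^d`, `|ζ| ≤ C` almost surely and `E[ζ | x] = 0`. -/
structure IsNoiseLaw (d : ℕ) (C : ℝ) (μ : Measure (EuclideanSpace ℝ (Fin d) × ℝ)) : Prop where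
  isProb : IsProbabilityMeasure μ
  covariate : μ.map Prod.fst = uniformOn (signCube d)
  bounded : ∀ᵐ p ∂μ, |p.2| ≤ C
  condMean : μ[(fun p : EuclideanSpace ℝ (Fin d) × ℝ => p.2) |
    MeasurableSpace.comap Prod.fst inferInstance] =ᵐ[μ] 0

/-- The law of `(x, y)` with `y = ⟨θ, x⟩ + ζ`, when `(x, ζ)` has law `μ`. -/
def regressionLaw {d : ℕ} (θ : EuclideanSpace ℝ (Fin d))
    (μ : Measure (EuclideanSpace ℝ (Fin d) × ℝ)) : Measure (EuclideanSpace ℝ (Fin d) × ℝ) :=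
  μ.map (fun p => (p.1, inner ℝ θ p.1 + p.2))

/-- The class `P_{k,d,C}`: all pairs `(θ, P)` where `‖θ‖₁ ≤ 1`, `‖θ‖₀ ≤ k` and `P` is the law
of `(x, ⟨θ, x⟩ + ζ)` for some admissible joint law of `(x, ζ)`. -/
def sparseRegressionClass (k d : ℕ) (C : ℝ) :
    Set (EuclideanSpace ℝ (Fin d) × Measure (EuclideanSpace ℝ (Fin d) × ℝ)) :=
  {q | (∑ i, |q.1 i|) ≤ 1 ∧ {i | q.1 i ≠ 0}.ncard ≤ k ∧
    ∃ μ, IsNoiseLaw d C μ ∧ q.2 = regressionLaw q.1 μ}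

/-- The data universe of the class `P_{k,d,2}`: `x ∈ {-1, +1}^d` and
`|y| ≤ ‖θ‖₁ + |ζ| ≤ 3`. -/
def dataUniverse (d : ℕ) : Set (EuclideanSpace ℝ (Fin d) × ℝ) :=
  signCube d ×ˢ Set.Icc (-3) 3

/-! ### Sequentially interactive locally private algorithms -/

/-- The space of message histories `(z_0, …, z_{m-1})`, where `z_i` lies in `Msg i`. -/
def Hist (Msg : ℕ → Type u) : ℕ → Type u
  | 0 => PUnit
  | m + 1 => Hist Msg m × Msg m

/-- The product σ-algebra on the space of histories. -/
instance Hist.measurableSpace (Msg : ℕ → Type u) [inst : ∀ m, MeasurableSpace (Msg m)] :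
    ∀ m, MeasurableSpace (Hist Msg m)
  | 0 => (⊤ : MeasurableSpace PUnit)
  | m + 1 => @Prod.instMeasurableSpace _ _ (Hist.measurableSpace Msg m) (inst m)

/-- A sequentially interactive algorithm for data in `V` with outputs in `Θ`, run on `n` users.
User `m < n` holds `v_m`, sees the earlier messages `h = (z_0, …, z_{m-1})` and sends a message with
law `Q m (v_m, h)`. The output is a (randomized) function of the messages `z_0, …, z_{n-1}`.
The kernels `Q m` with `m ≥ n` are never used. -/
structure SeqAlgorithm (V Θ : Type*) [MeasurableSpace V] [MeasurableSpace Θ] (n : ℕ) where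
  Msg : ℕ → Type u
  measMsg : ∀ m, MeasurableSpace (Msg m)
  Q : ∀ m, Kernel (V × Hist Msg m) (Msg m)
  markovQ : ∀ m, IsMarkovKernel (Q m)
  est : Kernel (Hist Msg n) Θ
  markovEst : IsMarkovKernel est

namespace SeqAlgorithm

variable {V Θ : Type*} [MeasurableSpace V] [MeasurableSpace Θ] {n : ℕ}

instance (A : SeqAlgorithm.{u} V Θ n) (m : ℕ) : MeasurableSpace (A.Msg m) := A.measMsg m

instance (A : SeqAlgorithm.{u} V Θ n) (m : ℕ) : IsMarkovKernel (A.Q m) := A.markovQ m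

instance (A : SeqAlgorithm.{u} V Θ n) : IsMarkovKernel A.est := A.markovEst

/-- The algorithm is `ε`-sequentially interactive locally differentially private on the data
universe `U`: every message is an `ε`-private view of the data of its sender, whatever the earlier
messages are. -/
def IsLDP (A : SeqAlgorithm.{u} V Θ n) (U : Set V) (ε : ℝ) : Prop :=
  ∀ m < n, ∀ h : Hist A.Msg m, ∀ v ∈ U, ∀ v' ∈ U, ∀ S : Set (A.Msg m), MeasurableSet S →
    A.Q m (v, h) S ≤ ENNReal.ofReal (Real.exp ε) * A.Q m (v', h) S

/-- The law of the first `m` messages, given the data `D` of the first `m` users: the message of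
user `m` is drawn from `Q m (D m, h)`, where `h` is the history of the first `m` messages. -/
def transcript (A : SeqAlgorithm.{u} V Θ n) : ∀ m : ℕ, Kernel (Fin m → V) (Hist A.Msg m)
  | 0 => Kernel.const _ (Measure.dirac PUnit.unit)
  | m + 1 =>
    ((A.transcript m).comap (fun D (i : Fin m) => D i.castSucc) (by fun_prop)) ⊗ₖ
      ((A.Q m).comap (fun p : (Fin (m + 1) → V) × Hist A.Msg m => (p.1 (Fin.last m), p.2))
        (by fun_prop))

/-- The transcript law is a probability measure for every data set. -/
instance transcript_markov (A : SeqAlgorithm.{u} V Θ n) :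
    ∀ m : ℕ, IsMarkovKernel (A.transcript m)
  | 0 => by
    unfold transcript
    exact Kernel.const.instIsMarkovKernel
      (hμβ := @Measure.dirac.isProbabilityMeasure PUnit (Hist.measurableSpace A.Msg 0) PUnit.unit)
  | m + 1 => by
    have := A.transcript_markov m
    unfold transcript
    exact Kernel.IsMarkovKernel.compProd _ _

/-- The law of the output of the algorithm on the data set `D`. -/
def output (A : SeqAlgorithm.{u} V Θ n) : Kernel (Fin n → V) Θ :=
  A.est ∘ₖ A.transcript n

/-- The expected error `E ‖A(D) - θ‖`, over `n` i.i.d. samples `D` from `P` and over the randomness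
of the algorithm. -/
def risk {d : ℕ} (A : SeqAlgorithm.{u} V (EuclideanSpace ℝ (Fin d)) n)
    (θ : EuclideanSpace ℝ (Fin d)) (P : Measure V) : ENNReal :=
  ∫⁻ D, ∫⁻ t, ‖t - θ‖ₑ ∂(A.output D) ∂(Measure.pi fun _ : Fin n => P)

end SeqAlgorithm

end

noncomputable section

/-! Assouad's method with a sparse prior, played against an entropy bound that privacy makes small.

Hard instances: let `y` be a sign with conditional mean `⟨θ, x⟩`, so that the data law has density
`1 + ∑ j, θ j * (y * x j)` relative to the uniform law on signs, affine in `θ`. Split `k * N`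
coordinates, `N = d / k`, into `k` blocks. In block `b` the vector `θ` has at most one nonzero
entry, of size `a`, at a position `ω b`, present exactly when the bit `s b` is on.

Estimation needs information: an estimator with error `ν` on all these vectors also decides the
bits, so for a typical block the transcript laws with the bit off and on overlap little. Since
overlap is at least `3/4` minus relative entropy, the choice `a * √k = 4 * ν` forces the average
entropy, summed over the blocks, to be at least `k / 4` (`le_sum_histKL`).

Privacy limits information: each message has a density `q` relative to that of a fixed reference
user, with `|q - 1| ≤ 2 * ε`. By the chain rule (`histKL_succ_le`), switching bit `b` costs per
message at most `3 * a ^ 2` times the mean squared correlation of `q` with the feature at position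
`ω b`. The features `y * x j` are orthogonal, so by Bessel the squared correlations over all `d`
positions sum to at most `4 * ε ^ 2` (`sum_msgCorr_sq_le`). With bit `b` off, the law does not
depend on `ω b`; averaging over this position therefore gains a factor `1 / N` even though later
messages depend on earlier ones (`sum_update_mul_le`). Hence the summed average entropy is at most
`24 * n * a ^ 2 * ε ^ 2 / N` (`sum_histKL_le`), and comparison with `k / 4` gives the sample size.
The risk bound follows by contraposition. -/

/-! ### Message densities and the likelihood of the transcript -/

/-- Two finite measures that dominate each other up to a factor `C` have a density between `C⁻¹`
and `C`. -/
theorem exists_density_mem_Icc {α : Type*} [MeasurableSpace α] {μ ν : Measure α}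
    [IsFiniteMeasure μ] [IsFiniteMeasure ν] {C : ℝ} (hC : 1 ≤ C)
    (h₁ : ∀ s, MeasurableSet s → μ s ≤ ENNReal.ofReal C * ν s)
    (h₂ : ∀ s, MeasurableSet s → ν s ≤ ENNReal.ofReal C * μ s) :
    ∃ f : α → ℝ, Measurable f ∧ (∀ x, f x ∈ Set.Icc C⁻¹ C) ∧
      μ = ν.withDensity fun x => ENNReal.ofReal (f x) := by
  have hC0 : 0 < C := by linarith
  have hac : μ ≪ ν := Measure.AbsolutelyContinuous.mk fun s hs h0 => by
    simpa [h0] using h₁ s hs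
  have hlt := μ.rnDeriv_lt_top ν
  have hint (s : Set α) : ∫⁻ x in s, μ.rnDeriv ν x ∂ν = μ s := by
    rw [Measure.setLIntegral_rnDeriv hac]
  have hle : ∀ᵐ x ∂ν, μ.rnDeriv ν x ≤ ENNReal.ofReal C := by
    refine ae_le_of_forall_setLIntegral_le_of_sigmaFinite (μ.measurable_rnDeriv ν)
      fun s hs _ => ?_
    rw [hint, setLIntegral_const]
    exact h₁ s hs
  have hge : ∀ᵐ x ∂ν, (ENNReal.ofReal C)⁻¹ ≤ μ.rnDeriv ν x := by
    refine ae_le_of_forall_setLIntegral_le_of_sigmaFinite measurable_const fun s hs _ => ?_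
    rw [hint, setLIntegral_const]
    have hC1 : ENNReal.ofReal C ≠ 0 := by simpa using hC0
    calc (ENNReal.ofReal C)⁻¹ * ν s ≤ (ENNReal.ofReal C)⁻¹ * (ENNReal.ofReal C * μ s) := by
          gcongr; exact h₂ s hs
      _ = μ s := by rw [← mul_assoc, ENNReal.inv_mul_cancel hC1 (by simp), one_mul]
  -- Truncation alters the Radon–Nikodym derivative only on a null set and turns the almost sure
  -- bounds into bounds at every point.
  refine ⟨fun x => max C⁻¹ (min C (μ.rnDeriv ν x).toReal),
    measurable_const.max (measurable_const.min (μ.measurable_rnDeriv ν).ennreal_toReal),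
    fun x => ⟨le_max_left _ _, max_le ((inv_le_one_of_one_le₀ hC).trans hC) (min_le_left _ _)⟩, ?_⟩
  refine (Measure.withDensity_rnDeriv_eq μ ν hac).symm.trans (withDensity_congr_ae ?_)
  filter_upwards [hle, hge, hlt] with x hx1 hx2 hx3
  have h1 : (μ.rnDeriv ν x).toReal ≤ C := ENNReal.toReal_le_of_le_ofReal hC0.le hx1
  have h2 : C⁻¹ ≤ (μ.rnDeriv ν x).toReal := by
    rw [← ENNReal.ofReal_inv_of_pos hC0] at hx2
    exact (ENNReal.ofReal_le_iff_le_toReal hx3.ne).1 hx2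
  rw [min_eq_right h1, max_eq_right h2, ENNReal.ofReal_toReal hx3.ne]

namespace SeqAlgorithm

variable {V Θ : Type*} [MeasurableSpace V] [MeasurableSpace Θ] {n : ℕ}

/-- The kernel of user `m` with the data `v` held fixed. -/
def msgKernel (A : SeqAlgorithm.{u} V Θ n) (m : ℕ) (v : V) : Kernel (Hist A.Msg m) (A.Msg m) :=
  (A.Q m).comap (fun h => (v, h)) (by fun_prop)

instance (A : SeqAlgorithm.{u} V Θ n) (m : ℕ) (v : V) : IsMarkovKernel (A.msgKernel m v) := by
  unfold msgKernel; infer_instance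

/-- The law of the first `m` messages when all users hold the same data `v`. -/
def baseLaw (A : SeqAlgorithm.{u} V Θ n) (v : V) (m : ℕ) : Measure (Hist A.Msg m) :=
  A.transcript m fun _ => v

instance (A : SeqAlgorithm.{u} V Θ n) (v : V) (m : ℕ) : IsProbabilityMeasure (A.baseLaw v m) := by
  unfold baseLaw; infer_instance

/-- The law of the first `m` messages, together with the next one, when all users hold the same
data `v`. -/
def stepLaw (A : SeqAlgorithm.{u} V Θ n) (v : V) (m : ℕ) : Measure (Hist A.Msg m × A.Msg m) :=
  A.baseLaw v m ⊗ₘ A.msgKernel m v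

instance (A : SeqAlgorithm.{u} V Θ n) (v : V) (m : ℕ) : IsProbabilityMeasure (A.stepLaw v m) := by
  unfold stepLaw; infer_instance

theorem lintegral_transcript_succ (A : SeqAlgorithm.{u} V Θ n) (m : ℕ) (D : Fin (m + 1) → V)
    {F : Hist A.Msg m × A.Msg m → ENNReal} (hF : Measurable F) :
    ∫⁻ p, F p ∂(A.transcript (m + 1) D : Measure (Hist A.Msg m × A.Msg m)) =
      ∫⁻ h, ∫⁻ z, F (h, z) ∂(A.msgKernel m (D (Fin.last m)) h)
        ∂(A.transcript m fun i => D i.castSucc) := by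
  have := A.transcript_markov m
  rw [transcript]
  erw [Kernel.lintegral_compProd _ _ _ hF]
  rfl

theorem baseLaw_succ (A : SeqAlgorithm.{u} V Θ n) (v : V) (m : ℕ) :
    A.baseLaw v (m + 1) = A.stepLaw v m := by
  refine Measure.ext_of_lintegral _ fun F hF => ?_
  erw [A.lintegral_transcript_succ m (fun _ => v) hF, Measure.lintegral_compProd hF]
  rfl

/-- `q` collects densities of the messages of users with data `v i`, relative to users with data
`v₀`. -/
structure IsMsgDensity {ι : Type*} (A : SeqAlgorithm.{u} V Θ n) (v₀ : V) (v : ι → V) (ε : ℝ)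
    (q : ∀ m, ι → Hist A.Msg m × A.Msg m → ℝ) : Prop where
  measurable : ∀ m i, Measurable (q m i)
  ge : ∀ m i p, 1 / 3 ≤ q m i p
  le : ∀ m i p, q m i p ≤ 3
  abs_sub_le : ∀ m i p, |q m i p - 1| ≤ 2 * ε
  compProd_eq : ∀ m < n, ∀ i, A.baseLaw v₀ m ⊗ₘ A.msgKernel m (v i) =
    (A.stepLaw v₀ m).withDensity fun p => ENNReal.ofReal (q m i p)

theorem exp_mem_bounds {ε x : ℝ} (hε : 0 < ε) (hε1 : ε ≤ 1)
    (hx : x ∈ Set.Icc (Real.exp ε)⁻¹ (Real.exp ε)) : 1 / 3 ≤ x ∧ x ≤ 3 ∧ |x - 1| ≤ 2 * ε := by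
  have h3 : Real.exp ε ≤ 3 :=
    (Real.exp_le_exp.2 hε1).trans (by linarith [Real.exp_one_lt_d9])
  have hpos := Real.exp_pos ε
  have h1 : 1 / 3 ≤ (Real.exp ε)⁻¹ := by
    rw [one_div]; exact inv_anti₀ hpos h3
  have h2 : 1 - ε ≤ (Real.exp ε)⁻¹ := by
    rw [← Real.exp_neg]; linarith [Real.add_one_le_exp (-ε)]
  have h4 : Real.exp ε ≤ 1 + 2 * ε := by
    have := Real.abs_exp_sub_one_le (x := ε) (by rw [abs_of_pos hε]; exact hε1)
    rw [abs_of_pos hε] at this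
    linarith [le_abs_self (Real.exp ε - 1)]
  refine ⟨h1.trans hx.1, hx.2.trans h3, abs_le.2 ⟨?_, ?_⟩⟩ <;> linarith [hx.1, hx.2]

/-- Privacy holds for every history, so it integrates to mutual domination of the joint laws of
history and next message. Taking the density of the joint laws, rather than one density per history,
makes it jointly measurable for arbitrary message spaces. -/
theorem IsLDP.exists_isMsgDensity {ι : Type*} {A : SeqAlgorithm.{u} V Θ n} {U : Set V} {ε : ℝ}
    (hA : A.IsLDP U ε) (hε : 0 < ε) (hε1 : ε ≤ 1) {v₀ : V} (hv₀ : v₀ ∈ U) {v : ι → V}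
    (hv : ∀ i, v i ∈ U) :
    ∃ q, A.IsMsgDensity v₀ v ε q := by
  have key (m : ℕ) (i : ι) : ∃ f : Hist A.Msg m × A.Msg m → ℝ, Measurable f ∧
      (∀ x, f x ∈ Set.Icc (Real.exp ε)⁻¹ (Real.exp ε)) ∧
      (m < n → A.baseLaw v₀ m ⊗ₘ A.msgKernel m (v i) =
        (A.baseLaw v₀ m ⊗ₘ A.msgKernel m v₀).withDensity fun p => ENNReal.ofReal (f p)) := by
    by_cases hm : m < n
    · have hle {a b : V} (ha : a ∈ U) (hb : b ∈ U) (s : Set (Hist A.Msg m × A.Msg m))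
          (hs : MeasurableSet s) : (A.baseLaw v₀ m ⊗ₘ A.msgKernel m a) s ≤
            ENNReal.ofReal (Real.exp ε) * (A.baseLaw v₀ m ⊗ₘ A.msgKernel m b) s := by
        rw [Measure.compProd_apply hs, Measure.compProd_apply hs,
          ← lintegral_const_mul _ (Kernel.measurable_kernel_prodMk_left hs)]
        exact lintegral_mono fun h => hA m hm h a ha b hb _ (measurable_prodMk_left hs)
      obtain ⟨f, hf, hf1, hf2⟩ := exists_density_mem_Icc (Real.one_le_exp hε.le)
        (hle (hv i) hv₀) (hle hv₀ (hv i))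
      exact ⟨f, hf, hf1, fun _ => hf2⟩
    · exact ⟨fun _ => 1, measurable_const, fun _ =>
        ⟨inv_le_one_of_one_le₀ (Real.one_le_exp hε.le), Real.one_le_exp hε.le⟩,
        fun h => absurd h hm⟩
  choose q hq1 hq2 hq3 using key
  exact ⟨q, hq1, fun m i p => (exp_mem_bounds hε hε1 (hq2 m i p)).1,
    fun m i p => (exp_mem_bounds hε hε1 (hq2 m i p)).2.1,
    fun m i p => (exp_mem_bounds hε hε1 (hq2 m i p)).2.2, fun m hm i => hq3 m i hm⟩

/-- The density of a message when the data of the sender are `v i` with probability `w i`. -/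
def mixDensity {ι : Type*} [Fintype ι] {A : SeqAlgorithm.{u} V Θ n}
    (q : ∀ m, ι → Hist A.Msg m × A.Msg m → ℝ) (w : ι → ℝ) (m : ℕ)
    (p : Hist A.Msg m × A.Msg m) : ℝ :=
  ∑ i, w i * q m i p

/-- The likelihood of a history when the data of each user are `v i` with probability `w i`. -/
def lik {ι : Type*} [Fintype ι] {A : SeqAlgorithm.{u} V Θ n}
    (q : ∀ m, ι → Hist A.Msg m × A.Msg m → ℝ) (w : ι → ℝ) : ∀ m, Hist A.Msg m → ℝ
  | 0 => fun _ => 1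
  | m + 1 => fun p => lik q w m p.1 * mixDensity q w m p

/-- The law of the first `m` messages when the data are i.i.d. with law `P`. -/
def iidLaw (A : SeqAlgorithm.{u} V Θ n) (P : Measure V) (m : ℕ) : Measure (Hist A.Msg m) :=
  A.transcript m ∘ₘ Measure.pi fun _ : Fin m => P

/-- Fubini: the data of the last user are independent of the data behind the earlier messages, so
they can be integrated out last. -/
theorem lintegral_iidLaw_succ (A : SeqAlgorithm.{u} V Θ n) (P : Measure V)
    [IsProbabilityMeasure P] (m : ℕ) {F : Hist A.Msg m × A.Msg m → ENNReal} (hF : Measurable F) :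
    ∫⁻ p, F p ∂(A.iidLaw P (m + 1) : Measure (Hist A.Msg m × A.Msg m)) =
      ∫⁻ v, ∫⁻ h, ∫⁻ z, F (h, z) ∂(A.msgKernel m v h) ∂(A.iidLaw P m) ∂P := by
  have hG : Measurable fun p : V × Hist A.Msg m => ∫⁻ z, F (p.2, z) ∂(A.Q m p) :=
    Measurable.lintegral_kernel_prod_right' (κ := A.Q m)
      (f := fun x : (V × Hist A.Msg m) × A.Msg m => F (x.1.2, x.2)) (by fun_prop)
  have hG' (v : V) : Measurable fun h => ∫⁻ z, F (h, z) ∂(A.msgKernel m v h) :=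
    hG.comp measurable_prodMk_left
  unfold iidLaw
  erw [Measure.lintegral_bind (A.transcript (m + 1)).measurable.aemeasurable hF.aemeasurable]
  simp_rw [A.lintegral_transcript_succ m _ hF]
  have hmp := measurePreserving_piFinSuccAbove (fun _ : Fin (m + 1) => P) (Fin.last m)
  have hH : Measurable fun x : V × (Fin m → V) =>
      ∫⁻ h, ∫⁻ z, F (h, z) ∂(A.msgKernel m x.1 h) ∂(A.transcript m x.2) := by
    have := Measurable.lintegral_kernel_prod_right'
      (κ := (A.transcript m).comap (Prod.snd : V × (Fin m → V) → _) measurable_snd)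
      (f := fun x : (V × (Fin m → V)) × Hist A.Msg m => ∫⁻ z, F (x.2, z) ∂(A.Q m (x.1.1, x.2)))
      (hG.comp (by fun_prop))
    exact this
  have h1 := hmp.lintegral_comp hH
  simp only [MeasurableEquiv.piFinSuccAbove_apply, Fin.insertNthEquiv_last,
    Fin.snocEquiv] at h1
  refine Eq.trans ?_ (h1.trans ?_)
  · rfl
  · rw [lintegral_prod _ hH.aemeasurable]
    refine lintegral_congr fun v => ?_
    rw [Measure.lintegral_bind (A.transcript m).measurable.aemeasurable (hG' v).aemeasurable]

end SeqAlgorithm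

/-- The law of `v i`, when `i` is drawn with the weights `w`. -/
def weightedLaw {ι V : Type*} [Fintype ι] [MeasurableSpace V] (v : ι → V) (w : ι → ℝ) :
    Measure V :=
  ∑ i, ENNReal.ofReal (w i) • Measure.dirac (v i)

theorem isProbabilityMeasure_weightedLaw {ι V : Type*} [Fintype ι] [MeasurableSpace V]
    (v : ι → V) {w : ι → ℝ} (hw : w ∈ stdSimplex ℝ ι) : IsProbabilityMeasure (weightedLaw v w) := by
  constructor
  simp only [weightedLaw, Measure.coe_finsetSum, Finset.sum_apply, Measure.smul_apply,
    measure_univ, smul_eq_mul, mul_one]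
  rw [← ENNReal.ofReal_sum_of_nonneg fun i _ => hw.1 i, hw.2, ENNReal.ofReal_one]

theorem lintegral_weightedLaw {ι V : Type*} [Fintype ι] [MeasurableSpace V]
    [MeasurableSingletonClass V] (v : ι → V) (w : ι → ℝ) (f : V → ENNReal) :
    ∫⁻ x, f x ∂(weightedLaw v w) = ∑ i, ENNReal.ofReal (w i) * f (v i) := by
  simp [weightedLaw, lintegral_smul_measure]

namespace SeqAlgorithm

variable {V Θ : Type*} [MeasurableSpace V] [MeasurableSpace Θ] {n : ℕ}
  {ι : Type*} {A : SeqAlgorithm.{u} V Θ n} {v₀ : V} {v : ι → V} {ε : ℝ}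
  {q : ∀ m, ι → Hist A.Msg m × A.Msg m → ℝ} {w w' : ι → ℝ}

theorem IsMsgDensity.lintegral_msgKernel (hq : A.IsMsgDensity v₀ v ε q) {m : ℕ} (hm : m < n)
    (i : ι) {F : Hist A.Msg m × A.Msg m → ENNReal} (hF : Measurable F) :
    ∫⁻ h, ∫⁻ z, F (h, z) ∂(A.msgKernel m (v i) h) ∂(A.baseLaw v₀ m) =
      ∫⁻ p, ENNReal.ofReal (q m i p) * F p
        ∂(A.stepLaw v₀ m) := by
  rw [← Measure.lintegral_compProd hF, hq.compProd_eq m hm i,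
    lintegral_withDensity_eq_lintegral_mul _ (hq.measurable m i).ennreal_ofReal hF]
  rfl

/-- Reweighting by `q m i` changes the law of the next message but not that of the history, which
remains the first marginal. -/
theorem IsMsgDensity.integral_mul_density (hq : A.IsMsgDensity v₀ v ε q) {m : ℕ} (hm : m < n)
    (i : ι) {G : Hist A.Msg m → ℝ} (hG : Measurable G) :
    ∫ p, q m i p * G p.1 ∂(A.stepLaw v₀ m) =
      ∫ h, G h ∂(A.baseLaw v₀ m) := by
  have h1 : ∫ p, G p.1 ∂(A.baseLaw v₀ m ⊗ₘ A.msgKernel m (v i)) = ∫ h, G h ∂(A.baseLaw v₀ m) := by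
    conv_rhs => rw [← Measure.fst_compProd (A.baseLaw v₀ m) (A.msgKernel m (v i)), Measure.fst]
    rw [integral_map measurable_fst.aemeasurable hG.aestronglyMeasurable]
  rw [← h1, hq.compProd_eq m hm i, integral_withDensity_eq_integral_toReal_smul
    (hq.measurable m i).ennreal_ofReal (by simp)]
  refine integral_congr_ae (Filter.Eventually.of_forall fun p => ?_)
  simp [ENNReal.toReal_ofReal (le_trans (by norm_num) (hq.ge m i p))]

variable [Fintype ι]

theorem IsMsgDensity.measurable_mixDensity (hq : A.IsMsgDensity v₀ v ε q) (w : ι → ℝ) (m : ℕ) :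
    Measurable (mixDensity q w m) := by
  unfold mixDensity
  exact Finset.measurable_sum _ fun i _ => (hq.measurable m i).const_mul _

theorem IsMsgDensity.mixDensity_mem (hq : A.IsMsgDensity v₀ v ε q) (hw : w ∈ stdSimplex ℝ ι)
    (m : ℕ) (p : Hist A.Msg m × A.Msg m) : mixDensity q w m p ∈ Set.Icc (1 / 3) 3 := by
  unfold mixDensity
  constructor
  · calc (1 / 3 : ℝ) = ∑ i, w i * (1 / 3) := by rw [← Finset.sum_mul, hw.2, one_mul]
      _ ≤ _ := Finset.sum_le_sum fun i _ => mul_le_mul_of_nonneg_left (hq.ge m i p) (hw.1 i)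
  · calc _ ≤ ∑ i, w i * 3 :=
          Finset.sum_le_sum fun i _ => mul_le_mul_of_nonneg_left (hq.le m i p) (hw.1 i)
      _ = 3 := by rw [← Finset.sum_mul, hw.2, one_mul]

theorem IsMsgDensity.measurable_lik (hq : A.IsMsgDensity v₀ v ε q) (w : ι → ℝ) :
    ∀ m, Measurable (lik q w m)
  | 0 => measurable_const
  | m + 1 => ((hq.measurable_lik w m).comp measurable_fst).mul (hq.measurable_mixDensity w m)

/-- Crude bounds, exponential in the number of messages; they only serve positivity and
integrability and never enter the final constant. -/
theorem IsMsgDensity.lik_mem (hq : A.IsMsgDensity v₀ v ε q) (hw : w ∈ stdSimplex ℝ ι) :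
    ∀ m (h : Hist A.Msg m), lik q w m h ∈ Set.Icc ((1 / 3 : ℝ) ^ m) (3 ^ m)
  | 0, _ => by simp [lik]
  | m + 1, p => by
    have h1 := hq.lik_mem hw m p.1
    have h2 := hq.mixDensity_mem hw m p
    have h3 : (0 : ℝ) ≤ lik q w m p.1 := le_trans (by positivity) h1.1
    have h4 : (0 : ℝ) ≤ mixDensity q w m p := le_trans (by positivity) h2.1
    rw [pow_succ, pow_succ]
    exact ⟨mul_le_mul h1.1 h2.1 (by positivity) h3, mul_le_mul h1.2 h2.2 h4 (by positivity)⟩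

theorem IsMsgDensity.lik_pos (hq : A.IsMsgDensity v₀ v ε q) (hw : w ∈ stdSimplex ℝ ι) (m : ℕ)
    (h : Hist A.Msg m) : 0 < lik q w m h :=
  lt_of_lt_of_le (by positivity) (hq.lik_mem hw m h).1

/-- Under i.i.d. data the next sender is independent of the history, so given the history the next
message has the mixture of the densities `q m i` as its density; the likelihoods multiply. -/
theorem IsMsgDensity.iidLaw_eq [MeasurableSingletonClass V] (hq : A.IsMsgDensity v₀ v ε q)
    (hw : w ∈ stdSimplex ℝ ι) : ∀ m ≤ n, A.iidLaw (weightedLaw v w) m =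
      (A.baseLaw v₀ m).withDensity fun h => ENNReal.ofReal (lik q w m h)
  | 0, _ => by
    have := isProbabilityMeasure_weightedLaw v hw
    have h1 : (fun h : Hist A.Msg 0 => ENNReal.ofReal (lik q w 0 h)) = 1 := by
      funext h; simp [lik]
    rw [h1, withDensity_one, iidLaw, baseLaw, transcript]
    ext s hs
    rw [Measure.bind_apply hs (Kernel.measurable _).aemeasurable]
    simp
  | m + 1, hm => by
    have := isProbabilityMeasure_weightedLaw v hw
    have hL : Measurable fun h => ENNReal.ofReal (lik q w m h) :=
      (hq.measurable_lik w m).ennreal_ofReal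
    have key : @Eq (Measure (Hist A.Msg m × A.Msg m)) (A.iidLaw (weightedLaw v w) (m + 1))
        ((A.stepLaw v₀ m).withDensity fun p =>
          ENNReal.ofReal (lik q w m p.1 * mixDensity q w m p)) := by
      have hL' : Measurable fun p : Hist A.Msg m × A.Msg m =>
          ENNReal.ofReal (lik q w m p.1 * mixDensity q w m p) :=
        (((hq.measurable_lik w m).comp measurable_fst).mul
          (hq.measurable_mixDensity w m)).ennreal_ofReal
      refine Measure.ext_of_lintegral (α := Hist A.Msg m × A.Msg m) _ fun F hF => ?_
      refine (A.lintegral_iidLaw_succ _ m hF).trans ?_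
      rw [lintegral_weightedLaw,
        lintegral_withDensity_eq_lintegral_mul _ hL' hF, hq.iidLaw_eq hw m (by omega)]
      have hstep (i : ι) : ∫⁻ h, ∫⁻ z, F (h, z) ∂(A.msgKernel m (v i) h)
          ∂((A.baseLaw v₀ m).withDensity fun h => ENNReal.ofReal (lik q w m h)) =
            ∫⁻ p, ENNReal.ofReal (q m i p) * (ENNReal.ofReal (lik q w m p.1) * F p)
              ∂(A.stepLaw v₀ m) := by
        have hLF : Measurable fun p : Hist A.Msg m × A.Msg m =>
            ENNReal.ofReal (lik q w m p.1) * F p := (hL.comp measurable_fst).mul hF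
        rw [← hq.lintegral_msgKernel (by omega) i hLF, lintegral_withDensity_eq_lintegral_mul _ hL
            (Measurable.lintegral_kernel_prod_right' (κ := A.msgKernel m (v i)) hF)]
        refine lintegral_congr fun h => ?_
        rw [Pi.mul_apply]
        exact (lintegral_const_mul _ (hF.comp measurable_prodMk_left)).symm
      simp_rw [hstep]
      have hmeas (i : ι) : Measurable fun p : Hist A.Msg m × A.Msg m =>
          ENNReal.ofReal (q m i p) * (ENNReal.ofReal (lik q w m p.1) * F p) :=
        (hq.measurable m i).ennreal_ofReal.mul ((hL.comp measurable_fst).mul hF)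
      simp_rw [← lintegral_const_mul _ (hmeas _)]
      rw [← lintegral_finsetSum _ fun i _ => (hmeas i).const_mul _]
      refine lintegral_congr fun p => ?_
      rw [Pi.mul_apply, ENNReal.ofReal_mul (hq.lik_pos hw m p.1).le, mixDensity,
        ENNReal.ofReal_sum_of_nonneg fun i _ =>
          mul_nonneg (hw.1 i) (le_trans (by norm_num) (hq.ge m i p)), Finset.mul_sum, Finset.sum_mul]
      refine Finset.sum_congr rfl fun i _ => ?_
      rw [ENNReal.ofReal_mul (hw.1 i)]
      ring
    refine key.trans ?_
    rw [baseLaw_succ]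
    rfl

theorem IsMsgDensity.integral_mul_mixDensity (hq : A.IsMsgDensity v₀ v ε q)
    (hw : w ∈ stdSimplex ℝ ι) {m : ℕ} (hm : m < n) {G : Hist A.Msg m → ℝ} (hG : Measurable G)
    {C : ℝ} (hC : ∀ h, |G h| ≤ C) :
    ∫ p, G p.1 * mixDensity q w m p ∂(A.stepLaw v₀ m) =
      ∫ h, G h ∂(A.baseLaw v₀ m) := by
  have hint (i : ι) : Integrable (fun p : Hist A.Msg m × A.Msg m => w i * (q m i p * G p.1))
      (A.stepLaw v₀ m) := by
    refine Integrable.const_mul (Integrable.of_bound ((hq.measurable m i).mul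
      (hG.comp measurable_fst)).aestronglyMeasurable (3 * C) (Filter.Eventually.of_forall fun p => ?_)) _
    change |q m i p * G p.1| ≤ 3 * C
    rw [abs_mul, abs_of_nonneg (le_trans (by norm_num) (hq.ge m i p))]
    exact mul_le_mul (hq.le m i p) (hC _) (abs_nonneg _) (by norm_num)
  have h1 (p : Hist A.Msg m × A.Msg m) : G p.1 * mixDensity q w m p =
      ∑ i, w i * (q m i p * G p.1) := by
    rw [mixDensity, Finset.mul_sum]
    exact Finset.sum_congr rfl fun i _ => by ring
  simp_rw [h1]
  rw [integral_finsetSum _ fun i _ => hint i]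
  simp_rw [integral_const_mul, hq.integral_mul_density hm _ hG, ← Finset.sum_mul, hw.2, one_mul]

theorem IsMsgDensity.integral_lik (hq : A.IsMsgDensity v₀ v ε q) (hw : w ∈ stdSimplex ℝ ι) :
    ∀ m ≤ n, ∫ h, lik q w m h ∂(A.baseLaw v₀ m) = 1
  | 0, _ => by simp [lik]
  | m + 1, hm => by
    rw [← hq.integral_lik hw m (by omega)]
    rw [baseLaw_succ]
    refine hq.integral_mul_mixDensity hw (by omega) (hq.measurable_lik w m) (C := 3 ^ m) fun h => ?_
    rw [abs_of_pos (hq.lik_pos hw m h)]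
    exact (hq.lik_mem hw m h).2

end SeqAlgorithm

/-! ### Relative entropy of the transcripts -/

/-- The overlap of two densities is bounded below by an affine function of the integrand of their
relative entropy. -/
theorem affine_klFun_le_min {x y : ℝ} (hx : 0 < x) (hy : 0 < y) :
    3 / 8 * (x + y) - (y - x + x * Real.log (x / y)) ≤ min x y := by
  -- With `s = √(y / x)`, the bound `log s ≤ s - 1` shows that the entropy integrand is at least the
  -- Hellinger integrand `x * (s - 1) ^ 2`. Both claims become quadratic inequalities in `s`, whose
  -- extremal points are `8/5` and `8/13`.
  obtain ⟨s, hs, hsq⟩ : ∃ s : ℝ, 0 < s ∧ y = x * s ^ 2 :=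
    ⟨√(y / x), Real.sqrt_pos.2 (div_pos hy hx), by rw [Real.sq_sqrt (div_pos hy hx).le]; field_simp⟩
  have hlog : Real.log (x / y) = -(2 * Real.log s) := by
    rw [hsq, ← div_div, div_self hx.ne', one_div, Real.log_inv, Real.log_pow]
    norm_num
  have h1 := Real.log_le_sub_one_of_pos hs
  have h2 : x * Real.log s ≤ x * (s - 1) := mul_le_mul_of_nonneg_left h1 hx.le
  rw [hlog, hsq]
  refine le_min ?_ ?_
  · have : 0 ≤ x * (s - 8 / 5) ^ 2 := by positivity
    nlinarith
  · have : 0 ≤ x * (s - 8 / 13) ^ 2 := by positivity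
    nlinarith

/-- The pointwise comparison of relative entropy with chi-square; the linear term `x - y` is kept
because it integrates to zero between probability densities. -/
theorem mul_log_div_le {x y : ℝ} (hx : 0 < x) (hy : 1 / 3 ≤ y) :
    x * Real.log (x / y) ≤ x - y + 3 * (x - y) ^ 2 := by
  have hy0 : 0 < y := by linarith
  have h1 := mul_le_mul_of_nonneg_left (Real.log_le_sub_one_of_pos (div_pos hx hy0)) hx.le
  have h2 : x * (x / y - 1) = x - y + (x - y) ^ 2 / y := by field_simp; ring
  have h3 : (x - y) ^ 2 / y ≤ 3 * (x - y) ^ 2 := by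
    rw [div_le_iff₀ hy0]
    nlinarith [sq_nonneg (x - y)]
  linarith

namespace SeqAlgorithm

variable {V Θ : Type*} [MeasurableSpace V] [MeasurableSpace Θ] {n : ℕ}
  {ι : Type*} [Fintype ι] {A : SeqAlgorithm.{u} V Θ n} {v₀ : V} {v : ι → V} {ε : ℝ}
  {q : ∀ m, ι → Hist A.Msg m × A.Msg m → ℝ} {w w' : ι → ℝ}

theorem IsMsgDensity.integrable_lik (hq : A.IsMsgDensity v₀ v ε q) (hw : w ∈ stdSimplex ℝ ι)
    (m : ℕ) : Integrable (lik q w m) (A.baseLaw v₀ m) :=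
  Integrable.of_mem_Icc _ _ (hq.measurable_lik w m).aemeasurable
    (Filter.Eventually.of_forall (hq.lik_mem hw m))

theorem IsMsgDensity.abs_log_le (hq : A.IsMsgDensity v₀ v ε q) (hw : w ∈ stdSimplex ℝ ι)
    (hw' : w' ∈ stdSimplex ℝ ι) (m : ℕ) (h : Hist A.Msg m) :
    |lik q w m h * Real.log (lik q w m h / lik q w' m h)| ≤ 3 ^ m * Real.log (9 ^ m) := by
  have h1 := hq.lik_mem hw m h
  have h2 := hq.lik_mem hw' m h
  have p1 := hq.lik_pos hw m h
  have p2 := hq.lik_pos hw' m h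
  have h9 : (9 : ℝ) ^ m = 3 ^ m * 3 ^ m := by rw [← mul_pow]; norm_num
  have h3 : (1 / 3 : ℝ) ^ m * 3 ^ m = 1 := by rw [← mul_pow]; norm_num
  have key {x y : ℝ} (hx : 0 < x) (hx' : x ≤ 3 ^ m) (hy : (1 / 3 : ℝ) ^ m ≤ y) :
      x / y ≤ 9 ^ m := by
    have hy0 : 0 < y := lt_of_lt_of_le (by positivity) hy
    rw [div_le_iff₀ hy0, h9]
    have : (1 : ℝ) ≤ 3 ^ m * y := by
      rw [← h3, mul_comm]; gcongr
    nlinarith [pow_pos (show (0 : ℝ) < 3 by norm_num) m]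
  rw [abs_mul, abs_of_pos p1]
  refine mul_le_mul h1.2 (abs_le.2 ⟨?_, ?_⟩) (abs_nonneg _) (by positivity)
  · rw [neg_le, ← Real.log_inv, inv_div]
    exact Real.log_le_log (div_pos p2 p1) (key p2 h2.2 h1.1)
  · exact Real.log_le_log (div_pos p1 p2) (key p1 h1.2 h2.1)

theorem IsMsgDensity.measurable_mul_log (hq : A.IsMsgDensity v₀ v ε q) (w w' : ι → ℝ) (m : ℕ) :
    Measurable fun h => lik q w m h * Real.log (lik q w m h / lik q w' m h) :=
  (hq.measurable_lik w m).mul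
    (Real.measurable_log.comp ((hq.measurable_lik w m).div (hq.measurable_lik w' m)))

theorem IsMsgDensity.integrable_mul_log (hq : A.IsMsgDensity v₀ v ε q) (hw : w ∈ stdSimplex ℝ ι)
    (hw' : w' ∈ stdSimplex ℝ ι) (m : ℕ) :
    Integrable (fun h => lik q w m h * Real.log (lik q w m h / lik q w' m h)) (A.baseLaw v₀ m) :=
  Integrable.of_bound (hq.measurable_mul_log w w' m).aestronglyMeasurable _
    (Filter.Eventually.of_forall (hq.abs_log_le hw hw' m))

/-- The relative entropy of the laws of the first `m` messages under two data laws. -/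
def histKL {A : SeqAlgorithm.{u} V Θ n} (v₀ : V) (q : ∀ m, ι → Hist A.Msg m × A.Msg m → ℝ)
    (w w' : ι → ℝ) (m : ℕ) : ℝ :=
  ∫ h, lik q w m h * Real.log (lik q w m h / lik q w' m h) ∂(A.baseLaw v₀ m)

theorem IsMsgDensity.integrable_lik_mul_sq (hq : A.IsMsgDensity v₀ v ε q)
    (hw : w ∈ stdSimplex ℝ ι) (hw' : w' ∈ stdSimplex ℝ ι) (m : ℕ) :
    Integrable (fun p => lik q w m p.1 * (mixDensity q w m p - mixDensity q w' m p) ^ 2)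
      (A.stepLaw v₀ m) := by
  refine Integrable.of_mem_Icc 0 (3 ^ m * 3 ^ 2) ((((hq.measurable_lik w m).comp
    measurable_fst).mul (((hq.measurable_mixDensity w m).sub
      (hq.measurable_mixDensity w' m)).pow_const 2)).aemeasurable)
        (Filter.Eventually.of_forall fun p => ?_)
  have h1 := hq.lik_mem hw m p.1
  have h2 := hq.mixDensity_mem hw m p
  have h3 := hq.mixDensity_mem hw' m p
  have p1 := (hq.lik_pos hw m p.1).le
  refine ⟨by positivity, mul_le_mul h1.2 ?_ (sq_nonneg _) (by positivity)⟩
  refine sq_le_sq' ?_ ?_ <;> linarith [h2.1, h2.2, h3.1, h3.2]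

/-- The chain rule: the logarithm of the likelihood ratio splits into a history part and a message
part. The history part integrates to the previous entropy, the linear term of `mul_log_div_le`
cancels because both mixture densities integrate to one given the history, and the square remains.
-/
theorem IsMsgDensity.histKL_succ_le (hq : A.IsMsgDensity v₀ v ε q) (hw : w ∈ stdSimplex ℝ ι)
    (hw' : w' ∈ stdSimplex ℝ ι) {m : ℕ} (hm : m < n) :
    histKL v₀ q w w' (m + 1) ≤ histKL v₀ q w w' m +
      3 * ∫ p, lik q w m p.1 * (mixDensity q w m p - mixDensity q w' m p) ^ 2
        ∂(A.stepLaw v₀ m) := by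
  set G : Hist A.Msg m → ℝ := fun h => lik q w m h * Real.log (lik q w m h / lik q w' m h) with hG
  have hGm : Measurable G := hq.measurable_mul_log w w' m
  have hI (x : ι → ℝ) (hx : x ∈ stdSimplex ℝ ι) {H : Hist A.Msg m → ℝ} (hH : Measurable H) {C : ℝ}
      (hC : ∀ h, |H h| ≤ C) : Integrable (fun p => H p.1 * mixDensity q x m p) (A.stepLaw v₀ m) := by
    refine Integrable.of_bound ((hH.comp measurable_fst).mul
      (hq.measurable_mixDensity x m)).aestronglyMeasurable (C * 3)
        (Filter.Eventually.of_forall fun p => ?_)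
    have h1 := hq.mixDensity_mem hx m p
    have h2 : 0 ≤ mixDensity q x m p := by linarith [h1.1]
    change |H p.1 * mixDensity q x m p| ≤ C * 3
    rw [abs_mul, abs_of_nonneg h2]
    exact mul_le_mul (hC _) h1.2 h2 ((abs_nonneg _).trans (hC p.1))
  have hLC (h : Hist A.Msg m) : |lik q w m h| ≤ 3 ^ m := by
    rw [abs_of_pos (hq.lik_pos hw m h)]; exact (hq.lik_mem hw m h).2
  have hGC := hq.abs_log_le hw hw' m
  have i1 := hI w hw hGm hGC
  have i2 := hI w hw (hq.measurable_lik w m) hLC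
  have i3 := hI w' hw' (hq.measurable_lik w m) hLC
  have i4 := (hq.integrable_lik_mul_sq hw hw' m).const_mul 3
  have e1 := hq.integral_mul_mixDensity hw hm hGm hGC
  have e2 := hq.integral_mul_mixDensity hw hm (hq.measurable_lik w m) hLC
  have e3 := hq.integral_mul_mixDensity hw' hm (hq.measurable_lik w m) hLC
  have hKL : histKL v₀ q w w' m = ∫ h, G h ∂(A.baseLaw v₀ m) := rfl
  calc histKL v₀ q w w' (m + 1)
      = ∫ p : Hist A.Msg m × A.Msg m, lik q w m p.1 * mixDensity q w m p *
          Real.log (lik q w m p.1 * mixDensity q w m p /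
            (lik q w' m p.1 * mixDensity q w' m p)) ∂(A.stepLaw v₀ m) := by
        rw [histKL, baseLaw_succ]; rfl
    _ ≤ ∫ p, G p.1 * mixDensity q w m p + (lik q w m p.1 * mixDensity q w m p -
          lik q w m p.1 * mixDensity q w' m p) +
          3 * (lik q w m p.1 * (mixDensity q w m p - mixDensity q w' m p) ^ 2)
            ∂(A.stepLaw v₀ m) := by
        refine integral_mono ?_ ((i1.add (i2.sub i3)).add i4) fun p => ?_
        · have := hq.integrable_mul_log hw hw' (m + 1)
          rw [baseLaw_succ] at this
          exact this
        · have p1 := hq.lik_pos hw m p.1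
          have p2 := hq.lik_pos hw' m p.1
          have m1 := hq.mixDensity_mem hw m p
          have m2 := hq.mixDensity_mem hw' m p
          have p3 : 0 < mixDensity q w m p := by linarith [m1.1]
          have p4 : 0 < mixDensity q w' m p := by linarith [m2.1]
          have h1 := mul_le_mul_of_nonneg_left (mul_log_div_le p3 m2.1) p1.le
          simp only [hG]
          rw [mul_div_mul_comm, Real.log_mul (div_pos p1 p2).ne' (div_pos p3 p4).ne']
          linarith
    _ = _ := by
        have i5 : Integrable (fun p => lik q w m p.1 * mixDensity q w m p -
          lik q w m p.1 * mixDensity q w' m p) (A.stepLaw v₀ m) := i2.sub i3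
        have i6 : Integrable (fun p => G p.1 * mixDensity q w m p +
          (lik q w m p.1 * mixDensity q w m p - lik q w m p.1 * mixDensity q w' m p))
          (A.stepLaw v₀ m) := i1.add i5
        rw [integral_add i6 i4, integral_add i1 i5, integral_sub i2 i3,
          integral_const_mul, e1, e2, e3, sub_self, add_zero, hKL]

theorem IsMsgDensity.histKL_le (hq : A.IsMsgDensity v₀ v ε q) (hw : w ∈ stdSimplex ℝ ι)
    (hw' : w' ∈ stdSimplex ℝ ι) : ∀ m ≤ n, histKL v₀ q w w' m ≤ 3 * ∑ j ∈ Finset.range m,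
      ∫ p, lik q w j p.1 * (mixDensity q w j p - mixDensity q w' j p) ^ 2 ∂(A.stepLaw v₀ j)
  | 0, _ => by simp [histKL, lik]
  | m + 1, hm => by
    rw [Finset.sum_range_succ, mul_add]
    linarith [hq.histKL_le hw hw' m (by omega), hq.histKL_succ_le hw hw' (m := m) (by omega)]

end SeqAlgorithm

/-! ### Averaging over one coordinate, and Bessel's inequality -/

/-- Exchanging `f b` with `j` is an involution on pairs `(f, j)`, so resampling one coordinate
preserves the uniform average. -/
theorem sum_sum_update {κ β M : Type*} [Fintype κ] [DecidableEq κ] [Fintype β]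
    [AddCommMonoid M] (b : κ) (F : (κ → β) → M) :
    ∑ f, ∑ j, F (Function.update f b j) = Fintype.card β • ∑ f, F f := by
  have hinv : Function.Involutive fun x : (κ → β) × β => (Function.update x.1 b x.2, x.1 b) := by
    intro x; simp
  calc ∑ f, ∑ j, F (Function.update f b j)
      = ∑ x : (κ → β) × β, F (Function.update x.1 b x.2) :=
        (Fintype.sum_prod_type fun x : (κ → β) × β => F (Function.update x.1 b x.2)).symm
    _ = ∑ x : (κ → β) × β, F x.1 :=
        Equiv.sum_comp hinv.toPerm fun x : (κ → β) × β => F x.1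
    _ = _ := by simp [Fintype.sum_prod_type, Finset.smul_sum]

theorem sum_update_bool {κ : Type*} [Fintype κ] [DecidableEq κ] (b : κ) (F : (κ → Bool) → ℝ) :
    ∑ s, (F (Function.update s b false) + F (Function.update s b true)) = 2 * ∑ s, F s := by
  have := sum_sum_update b F
  simp only [Fintype.sum_bool, Fintype.card_bool, nsmul_eq_mul, Nat.cast_ofNat] at this
  rw [← this]
  exact Finset.sum_congr rfl fun s _ => add_comm _ _

/-- Switching off one block and averaging over its position decouples the weights from the
position. -/
theorem sum_update_mul_le {k N : ℕ} {L : (Fin k → Fin N) → (Fin k → Bool) → ℝ}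
    (hL : ∀ ω s, 0 ≤ L ω s)
    (hinv : ∀ ω s b j, L (Function.update ω b j) (Function.update s b false) =
      L ω (Function.update s b false))
    {C : Fin k → Fin N → ℝ} (hC : ∀ b j, 0 ≤ C b j) :
    N * ∑ b, ∑ ω, ∑ s, L ω (Function.update s b false) * C b (ω b) ≤
      2 * (∑ ω, ∑ s, L ω s) * ∑ b, ∑ j, C b j := by
  rw [Finset.mul_sum, Finset.mul_sum]
  refine Finset.sum_le_sum fun b _ => ?_
  -- Resampling `ω b` leaves the weight untouched by `hinv`, so only `C b` is averaged over the
  -- positions of the block.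
  have h1 := sum_sum_update b fun ω => ∑ s, L ω (Function.update s b false) * C b (ω b)
  simp only [Fintype.card_fin, nsmul_eq_mul, Function.update_self, hinv, ← Finset.sum_mul,
    ← Finset.mul_sum] at h1
  -- Adding the nonnegative terms with bit `b` on replaces the weight by one common to all blocks,
  -- at the cost of the factor `2`; the sum over `b` then acts on `C` alone.
  have h2 (ω : Fin k → Fin N) : ∑ s, L ω (Function.update s b false) ≤ 2 * ∑ s, L ω s := by
    rw [← sum_update_bool b]
    exact Finset.sum_le_sum fun s _ => le_add_of_nonneg_right (hL _ _)
  simp only [← Finset.sum_mul]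
  rw [← h1]
  refine mul_le_mul_of_nonneg_right ?_ (Finset.sum_nonneg fun j _ => hC b j)
  rw [Finset.mul_sum]
  exact Finset.sum_le_sum fun ω _ => h2 ω

/-- Bessel's inequality for centred orthogonal functions on a finite set. -/
theorem sum_sq_sum_mul_le {ι κ : Type*} [Fintype ι] [Fintype κ] [DecidableEq κ] {N : ℝ}
    (hN : 0 < N) {f : κ → ι → ℝ} (hf : ∀ j l, ∑ i, f j i * f l i = if j = l then N else 0)
    (g : ι → ℝ) : ∑ j, (∑ i, f j i * g i) ^ 2 ≤ N * ∑ i, g i ^ 2 := by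
  set c : κ → ℝ := fun j => ∑ i, f j i * g i with hc
  -- Expanding the squared residual, scaled by `N`, of the projection of `g` onto the span of the `f
  -- j` gives the inequality.
  have h0 : 0 ≤ ∑ i, (N * g i - ∑ j, c j * f j i) ^ 2 := Finset.sum_nonneg fun i _ => sq_nonneg _
  have h1 : ∑ i, g i * ∑ j, c j * f j i = ∑ j, c j ^ 2 := by
    simp_rw [Finset.mul_sum]
    rw [Finset.sum_comm]
    refine Finset.sum_congr rfl fun j _ => ?_
    rw [sq]
    nth_rewrite 3 [hc]
    simp only [Finset.mul_sum]
    exact Finset.sum_congr rfl fun i _ => by ring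
  have h2 : ∑ i, (∑ j, c j * f j i) ^ 2 = N * ∑ j, c j ^ 2 := by
    have h3 (i : ι) : (∑ j, c j * f j i) ^ 2 = ∑ j, ∑ l, c j * c l * (f j i * f l i) := by
      rw [sq, Finset.sum_mul_sum]
      exact Finset.sum_congr rfl fun j _ => Finset.sum_congr rfl fun l _ => by ring
    simp_rw [h3]
    rw [Finset.sum_comm, Finset.mul_sum]
    refine Finset.sum_congr rfl fun j _ => ?_
    rw [Finset.sum_comm]
    simp_rw [← Finset.mul_sum, hf]
    simp
    ring
  have h4 : ∑ i, (N * g i - ∑ j, c j * f j i) ^ 2 =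
      N ^ 2 * ∑ i, g i ^ 2 - 2 * N * ∑ i, g i * ∑ j, c j * f j i +
        ∑ i, (∑ j, c j * f j i) ^ 2 := by
    rw [Finset.mul_sum, Finset.mul_sum, ← Finset.sum_sub_distrib, ← Finset.sum_add_distrib]
    exact Finset.sum_congr rfl fun i _ => by ring
  rw [h4, h1, h2] at h0
  have h5 : 0 ≤ N * (N * ∑ i, g i ^ 2 - ∑ j, c j ^ 2) := by linarith
  linarith [nonneg_of_mul_nonneg_right h5 hN]

/-! ### Sign data -/

/-- The sign `±1` of a bit. -/
def bitSign (b : Bool) : ℝ := if b then 1 else -1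

@[simp] theorem bitSign_mul_self (b : Bool) : bitSign b * bitSign b = 1 := by
  cases b <;> simp [bitSign]

@[simp] theorem bitSign_not (b : Bool) : bitSign (!b) = -bitSign b := by
  cases b <;> simp [bitSign]

theorem abs_bitSign (b : Bool) : |bitSign b| = 1 := by
  cases b <;> simp [bitSign]

/-- The index set of the data points `(x, y)` with `x ∈ {±1}^d` and `y ∈ {±1}`. -/
abbrev SignData (d : ℕ) : Type := (Fin d → Bool) × Bool

/-- The product `y x_j`. -/
def signFeature {d : ℕ} (j : Fin d) (i : SignData d) : ℝ := bitSign i.2 * bitSign (i.1 j)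

theorem abs_signFeature {d : ℕ} (j : Fin d) (i : SignData d) : |signFeature j i| = 1 := by
  rw [signFeature, abs_mul, abs_bitSign, abs_bitSign, one_mul]

theorem sum_signFeature {d : ℕ} (j : Fin d) : ∑ i, signFeature j i = 0 := by
  simp [Fintype.sum_prod_type, signFeature, bitSign]

theorem sum_signFeature_mul {d : ℕ} (j l : Fin d) :
    ∑ i, signFeature j i * signFeature l i = if j = l then (2 : ℝ) ^ (d + 1) else 0 := by
  split_ifs with h
  · subst h
    have (i : SignData d) : signFeature j i * signFeature j i = 1 := by
      rw [← abs_mul_abs_self, abs_signFeature, one_mul]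
    simp [this, pow_succ]
  -- Flipping the `j`th bit changes the sign of the feature `j` and of no other, so the sum equals
  -- its own negative.
  · have hinv : Function.Involutive fun i : SignData d =>
        ((Function.update i.1 j (!i.1 j), i.2) : SignData d) := by
      intro i; simp
    have h1 := Equiv.sum_comp hinv.toPerm fun i : SignData d => signFeature j i * signFeature l i
    have h2 (i : SignData d) : signFeature j (hinv.toPerm _ i) * signFeature l (hinv.toPerm _ i) =
        -(signFeature j i * signFeature l i) := by
      simp [signFeature, Function.Involutive.toPerm, Function.update_of_ne (Ne.symm h)]
    simp_rw [h2, Finset.sum_neg_distrib] at h1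
    linarith

/-- The probability of `(x, y)` when `x` is uniform and `y` is a sign with mean `⟨θ, x⟩`. -/
def signWeight {d : ℕ} (θ : Fin d → ℝ) (i : SignData d) : ℝ :=
  (1 + ∑ j, θ j * signFeature j i) / 2 ^ (d + 1)

theorem signWeight_mem_stdSimplex {d : ℕ} {θ : Fin d → ℝ} (hθ : ∑ j, |θ j| ≤ 1) :
    signWeight θ ∈ stdSimplex ℝ (SignData d) := by
  constructor
  · intro i
    have h1 : |∑ j, θ j * signFeature j i| ≤ 1 := by
      refine (Finset.abs_sum_le_sum_abs _ _).trans (le_trans (le_of_eq ?_) hθ)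
      exact Finset.sum_congr rfl fun j _ => by rw [abs_mul, abs_signFeature, mul_one]
    have := (abs_le.1 h1).1
    exact div_nonneg (by linarith) (by positivity)
  · unfold signWeight
    rw [← Finset.sum_div, Finset.sum_add_distrib, Finset.sum_comm]
    simp_rw [← Finset.mul_sum, sum_signFeature]
    simp [pow_succ]

namespace SeqAlgorithm

variable {V Θ : Type*} [MeasurableSpace V] [MeasurableSpace Θ] {n d : ℕ}
  {A : SeqAlgorithm.{u} V Θ n} {v₀ : V} {v : SignData d → V} {ε : ℝ}
  {q : ∀ m, SignData d → Hist A.Msg m × A.Msg m → ℝ}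

/-- The correlation of the density of a message with the `j`th feature. -/
def msgCorr (q : ∀ m, SignData d → Hist A.Msg m × A.Msg m → ℝ) (m : ℕ) (j : Fin d)
    (p : Hist A.Msg m × A.Msg m) : ℝ :=
  (∑ i, signFeature j i * q m i p) / 2 ^ (d + 1)

/-- The features are centred, so `q` may be replaced by `q - 1`, which privacy bounds by `2 * ε`.
Bessel then bounds all `d` squared correlations together, with no dimension factor. -/
theorem IsMsgDensity.sum_msgCorr_sq_le (hq : A.IsMsgDensity v₀ v ε q) (m : ℕ)
    (p : Hist A.Msg m × A.Msg m) : ∑ j, msgCorr q m j p ^ 2 ≤ 4 * ε ^ 2 := by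
  have hN : (0 : ℝ) < 2 ^ (d + 1) := by positivity
  have h1 := sum_sq_sum_mul_le hN (sum_signFeature_mul (d := d)) fun i => q m i p - 1
  have h2 (j : Fin d) : ∑ i, signFeature j i * (q m i p - 1) = 2 ^ (d + 1) * msgCorr q m j p := by
    rw [msgCorr, mul_div_cancel₀ _ hN.ne']
    simp_rw [mul_sub, mul_one, Finset.sum_sub_distrib, sum_signFeature, sub_zero]
  have h3 : ∑ i, (q m i p - 1) ^ 2 ≤ 2 ^ (d + 1) * (4 * ε ^ 2) := by
    calc ∑ i, (q m i p - 1) ^ 2 ≤ ∑ _i : SignData d, 4 * ε ^ 2 := by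
          refine Finset.sum_le_sum fun i _ => ?_
          have := pow_le_pow_left₀ (abs_nonneg _) (hq.abs_sub_le m i p) 2
          rw [sq_abs] at this
          linarith
      _ = _ := by simp [pow_succ]
  simp_rw [h2, mul_pow, ← Finset.mul_sum] at h1
  have h4 : (2 ^ (d + 1)) ^ 2 * ∑ j, msgCorr q m j p ^ 2 ≤ (2 ^ (d + 1)) ^ 2 * (4 * ε ^ 2) := by
    calc _ ≤ _ := h1
      _ ≤ 2 ^ (d + 1) * (2 ^ (d + 1) * (4 * ε ^ 2)) := by gcongr
      _ = _ := by ring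
  exact le_of_mul_le_mul_left h4 (by positivity)

/-- The weights are affine in `θ`, so a change of `θ` acts on the message density linearly through
the correlations. -/
theorem mixDensity_signWeight_sub (θ θ' : Fin d → ℝ) (m : ℕ) (p : Hist A.Msg m × A.Msg m) :
    mixDensity q (signWeight θ) m p - mixDensity q (signWeight θ') m p =
      ∑ j, (θ j - θ' j) * msgCorr q m j p := by
  have h (i : SignData d) : signWeight θ i * q m i p - signWeight θ' i * q m i p =
      ∑ j, (θ j - θ' j) * (signFeature j i * q m i p / 2 ^ (d + 1)) := by
    simp only [signWeight, sub_mul, Finset.sum_sub_distrib, add_div, add_mul, Finset.sum_div,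
      Finset.sum_mul]
    rw [add_sub_add_left_eq_sub]
    congr 1 <;> exact Finset.sum_congr rfl fun j _ => by ring
  rw [mixDensity, mixDensity, ← Finset.sum_sub_distrib]
  simp_rw [h]
  rw [Finset.sum_comm]
  simp_rw [msgCorr, ← Finset.mul_sum, ← Finset.sum_div]

end SeqAlgorithm

/-! ### Sign data as a sparse regression model -/

/-- The vector of signs of a vector of bits. -/
def signVec {d : ℕ} (x : Fin d → Bool) : EuclideanSpace ℝ (Fin d) :=
  WithLp.toLp 2 fun j => bitSign (x j)

/-- The data point indexed by `i`. -/
def signPoint {d : ℕ} (i : SignData d) : EuclideanSpace ℝ (Fin d) × ℝ := (signVec i.1, bitSign i.2)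

theorem signVec_injective {d : ℕ} : Function.Injective (signVec (d := d)) := by
  intro x y h
  funext j
  have h1 : bitSign (x j) = bitSign (y j) := congrArg (fun z : EuclideanSpace ℝ (Fin d) => z j) h
  cases hx : x j <;> cases hy : y j <;> simp [hx, hy, bitSign] at h1 ⊢ <;> norm_num at h1

theorem range_signVec {d : ℕ} : Set.range (signVec (d := d)) = signCube d := by
  ext z
  constructor
  · rintro ⟨x, rfl⟩ j
    change bitSign (x j) = 1 ∨ bitSign (x j) = -1
    cases x j <;> simp [bitSign]
  · intro hz
    refine ⟨fun j => decide (z j = 1), ?_⟩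
    ext j
    change bitSign (decide (z j = 1)) = z j
    rcases hz j with h | h <;> norm_num [bitSign, h]

theorem signPoint_mem_dataUniverse {d : ℕ} (i : SignData d) : signPoint i ∈ dataUniverse d := by
  refine ⟨range_signVec ▸ ⟨i.1, rfl⟩, ?_⟩
  change bitSign i.2 ∈ Set.Icc (-3 : ℝ) 3
  cases i.2 <;> norm_num [bitSign]

theorem uniformOn_signCube (d : ℕ) :
    uniformOn (signCube d) =
      ∑ x : Fin d → Bool, ENNReal.ofReal ((2 ^ d : ℝ)⁻¹) • Measure.dirac (signVec x) := by
  have hc (s : Set (EuclideanSpace ℝ (Fin d))) : Measure.count (signCube d ∩ s) =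
      ∑ x : Fin d → Bool, Measure.dirac (signVec x) s := by
    rw [← range_signVec, ← Set.image_preimage_eq_range_inter,
      Measure.count_injective_image signVec_injective, Measure.count_apply_finite _ (Set.toFinite _)]
    classical
    simp only [Measure.dirac_apply, Set.indicator_apply, Pi.one_apply, Finset.sum_boole]
    congr 2
    ext x
    simp
  have h1 : Measure.count (signCube d) = 2 ^ d := by
    have := hc Set.univ
    rw [Set.inter_univ] at this
    rw [this]; simp
  have hm : MeasurableSet (signCube d) := by
    rw [← range_signVec]; exact (Set.finite_range _).measurableSet
  refine Measure.ext fun s _ => ?_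
  rw [uniformOn, cond_apply hm, hc, h1, Measure.coe_finsetSum, Finset.sum_apply, Finset.mul_sum]
  refine Finset.sum_congr rfl fun x _ => ?_
  rw [Measure.smul_apply, smul_eq_mul, ENNReal.ofReal_inv_of_pos (by positivity),
    ENNReal.ofReal_pow (by norm_num)]
  norm_num

theorem integral_weightedLaw {ι V : Type*} [Fintype ι] [MeasurableSpace V]
    [MeasurableSingletonClass V] (v : ι → V) {w : ι → ℝ} (hw : ∀ i, 0 ≤ w i) (f : V → ℝ) :
    ∫ x, f x ∂(weightedLaw v w) = ∑ i, w i * f (v i) := by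
  rw [weightedLaw, integral_finsetSum_measure]
  · simp [integral_smul_measure, ENNReal.toReal_ofReal (hw _)]
  · intro i _
    exact (integrable_dirac (by simp)).smul_measure (by simp)

theorem map_weightedLaw {ι V W : Type*} [Fintype ι] [MeasurableSpace V] [MeasurableSpace W]
    (v : ι → V) (w : ι → ℝ) {f : V → W} (hf : Measurable f) :
    (weightedLaw v w).map f = weightedLaw (fun i => f (v i)) w := by
  rw [weightedLaw, Measure.map_finset_sum hf.aemeasurable]
  simp [weightedLaw, Measure.map_smul, Measure.map_dirac' hf]

theorem inner_signVec {d : ℕ} (θ : EuclideanSpace ℝ (Fin d)) (x : Fin d → Bool) :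
    inner ℝ θ (signVec x) = ∑ j, θ j * bitSign (x j) := by
  simp [PiLp.inner_apply, signVec, mul_comm]

theorem signWeight_eq {d : ℕ} (θ : EuclideanSpace ℝ (Fin d)) (i : SignData d) :
    signWeight (fun j => θ j) i =
      (1 + bitSign i.2 * inner ℝ θ (signVec i.1)) / 2 ^ (d + 1) := by
  rw [signWeight, inner_signVec, Finset.mul_sum]
  congr 2
  exact Finset.sum_congr rfl fun j _ => by rw [signFeature]; ring

/-- The noise law under which the label of `x` is a sign with mean `⟨θ, x⟩`. -/
def signNoiseLaw {d : ℕ} (θ : EuclideanSpace ℝ (Fin d)) :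
    Measure (EuclideanSpace ℝ (Fin d) × ℝ) :=
  weightedLaw (fun i : SignData d => (signVec i.1, bitSign i.2 - inner ℝ θ (signVec i.1)))
    (signWeight fun j => θ j)

theorem regressionLaw_signNoiseLaw {d : ℕ} (θ : EuclideanSpace ℝ (Fin d)) :
    regressionLaw θ (signNoiseLaw θ) = weightedLaw signPoint (signWeight fun j => θ j) := by
  rw [regressionLaw, signNoiseLaw, map_weightedLaw _ _ (by fun_prop)]
  congr 1
  funext i
  simp [signPoint]

/-- The noise is `y - ⟨θ, x⟩`. The bound `‖θ‖₁ ≤ 1` gives `|⟨θ, x⟩| ≤ 1`, which makes the weights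
nonnegative and bounds the noise by `2`. -/
theorem isNoiseLaw_signNoiseLaw {d : ℕ} {θ : EuclideanSpace ℝ (Fin d)} (hθ : ∑ j, |θ j| ≤ 1) :
    IsNoiseLaw d 2 (signNoiseLaw θ) := by
  have hw := signWeight_mem_stdSimplex hθ
  have hprob : IsProbabilityMeasure (signNoiseLaw θ) := isProbabilityMeasure_weightedLaw _ hw
  have hbound (i : SignData d) : |bitSign i.2 - inner ℝ θ (signVec i.1)| ≤ 2 := by
    refine (abs_sub _ _).trans ?_
    have : |inner ℝ θ (signVec i.1)| ≤ 1 := by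
      rw [inner_signVec]
      refine (Finset.abs_sum_le_sum_abs _ _).trans (le_trans (le_of_eq ?_) hθ)
      exact Finset.sum_congr rfl fun j _ => by rw [abs_mul, abs_bitSign, mul_one]
    rw [abs_bitSign]; linarith
  have hbdd : ∀ᵐ p ∂(signNoiseLaw θ), |p.2| ≤ 2 := by
    rw [ae_iff, signNoiseLaw, weightedLaw]
    simp [Measure.coe_finsetSum, Finset.sum_apply, hbound]
  refine ⟨hprob, ?_, hbdd, ?_⟩
  · rw [signNoiseLaw, map_weightedLaw _ _ measurable_fst, uniformOn_signCube, weightedLaw,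
      Fintype.sum_prod_type]
    refine Finset.sum_congr rfl fun x _ => ?_
    change ∑ y, ENNReal.ofReal (signWeight (fun j => θ j) (x, y)) • Measure.dirac (signVec x) = _
    rw [← Finset.sum_smul]
    congr 1
    rw [← ENNReal.ofReal_sum_of_nonneg fun y _ => hw.1 (x, y), Fintype.sum_bool, signWeight_eq,
      signWeight_eq]
    congr 1
    simp only [bitSign]
    field_simp
    simp
    ring
  · symm
    refine ae_eq_condExp_of_forall_setIntegral_eq measurable_fst.comap_le ?_ ?_ ?_ ?_
    · exact Integrable.of_bound measurable_snd.aestronglyMeasurable 2 hbdd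
    · intro s _ _; exact integrableOn_zero
    · rintro s ⟨t, ht, rfl⟩ _
      simp only [Pi.zero_apply, integral_zero]
      rw [← integral_indicator (measurable_fst ht), signNoiseLaw, integral_weightedLaw _ hw.1, Fintype.sum_prod_type]
      symm
      -- For fixed `x` with `u = ⟨θ, x⟩`, the two labels contribute multiples of `(1 + u) * (1 - u)`
      -- and `(1 - u) * (-1 - u)`, which cancel.
      refine Finset.sum_eq_zero fun x _ => ?_
      rw [Fintype.sum_bool, signWeight_eq, signWeight_eq]
      by_cases hx : signVec x ∈ t
      · simp only [Set.indicator, Set.mem_preimage, hx, if_true, bitSign]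
        simp
        ring
      · simp [Set.indicator, hx]
    · exact aestronglyMeasurable_zero

/-- The law of the sign data belongs to the class of sparse regression models. -/
theorem signPoint_mem_sparseRegressionClass {k d : ℕ} {θ : EuclideanSpace ℝ (Fin d)}
    (hθ : ∑ j, |θ j| ≤ 1) (hk : {i | θ i ≠ 0}.ncard ≤ k) :
    (θ, weightedLaw signPoint (signWeight fun j => θ j)) ∈ sparseRegressionClass k d 2 :=
  ⟨hθ, hk, signNoiseLaw θ, isNoiseLaw_signNoiseLaw hθ, (regressionLaw_signNoiseLaw θ).symm⟩

/-! ### Block-sparse vectors -/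

/-- The vector with value `a` at `e (b, ω b)` for the blocks `b` that are switched on by `s`. -/
def blockVec {k N d : ℕ} (a : ℝ) (e : Fin k × Fin N → Fin d) (ω : Fin k → Fin N)
    (s : Fin k → Bool) : EuclideanSpace ℝ (Fin d) :=
  WithLp.toLp 2 fun i => ∑ b, if e (b, ω b) = i then (if s b then a else 0) else 0

section blockVec

variable {k N d : ℕ} {a : ℝ} {e : Fin k × Fin N → Fin d}

theorem blockVec_apply (ω : Fin k → Fin N) (s : Fin k → Bool) (i : Fin d) :
    blockVec a e ω s i = ∑ b, if e (b, ω b) = i then (if s b then a else 0) else 0 := rfl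

theorem blockVec_apply_self (he : Function.Injective e) (ω : Fin k → Fin N) (s : Fin k → Bool)
    (b : Fin k) : blockVec a e ω s (e (b, ω b)) = if s b then a else 0 := by
  rw [blockVec_apply, Finset.sum_eq_single b, if_pos rfl]
  · intro b' _ hb
    exact if_neg fun h => hb (congrArg Prod.fst (he h))
  · simp

theorem sum_abs_blockVec_le (ha : 0 ≤ a) (ω : Fin k → Fin N) (s : Fin k → Bool) :
    ∑ i, |blockVec a e ω s i| ≤ k * a := by
  calc ∑ i, |blockVec a e ω s i|
      ≤ ∑ i, ∑ b, |if e (b, ω b) = i then (if s b then a else 0) else 0| :=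
        Finset.sum_le_sum fun i _ => by
          rw [blockVec_apply]; exact Finset.abs_sum_le_sum_abs _ _
    _ = ∑ b, |if s b then a else 0| := by
        rw [Finset.sum_comm]
        refine Finset.sum_congr rfl fun b _ => ?_
        rw [Finset.sum_eq_single (e (b, ω b))]
        · rw [if_pos rfl]
        · intro i _ hi
          rw [if_neg hi.symm, abs_zero]
        · simp
    _ ≤ ∑ _b : Fin k, a := by
        refine Finset.sum_le_sum fun b _ => ?_
        split_ifs <;> simp [abs_of_nonneg ha, ha]
    _ = k * a := by simp

theorem ncard_blockVec_le (ω : Fin k → Fin N) (s : Fin k → Bool) :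
    {i | blockVec a e ω s i ≠ 0}.ncard ≤ k := by
  have hsub : {i | blockVec a e ω s i ≠ 0} ⊆ Set.range fun b => e (b, ω b) := by
    intro i hi
    rw [Set.mem_ofPred_eq, blockVec_apply] at hi
    obtain ⟨b, _, hb⟩ := Finset.exists_ne_zero_of_sum_ne_zero hi
    exact ⟨b, by by_contra h; exact hb (if_neg h)⟩
  calc _ ≤ (Set.range fun b => e (b, ω b)).ncard := Set.ncard_le_ncard hsub (Set.toFinite _)
    _ ≤ (Set.univ : Set (Fin k)).ncard := by
        rw [← Set.image_univ]; exact Set.ncard_image_le (Set.toFinite _)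
    _ = k := by simp [Set.ncard_univ]

theorem blockVec_update_sub (ω : Fin k → Fin N) (s : Fin k → Bool) (b : Fin k) (i : Fin d) :
    blockVec a e ω (Function.update s b false) i - blockVec a e ω (Function.update s b true) i =
      if e (b, ω b) = i then -a else 0 := by
  rw [blockVec_apply, blockVec_apply, ← Finset.sum_sub_distrib, Finset.sum_eq_single b]
  · simp only [Function.update_self]; split_ifs <;> simp_all
  · intro b' _ hb
    simp [Function.update_of_ne hb]
  · simp

theorem blockVec_update_update (ω : Fin k → Fin N) (s : Fin k → Bool) (b : Fin k) (j : Fin N) :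
    blockVec a e (Function.update ω b j) (Function.update s b false) =
      blockVec a e ω (Function.update s b false) := by
  ext i
  rw [blockVec_apply, blockVec_apply]
  refine Finset.sum_congr rfl fun b' _ => ?_
  by_cases hb : b' = b
  · subst hb; simp
  · simp [Function.update_of_ne hb]

/-- Cauchy–Schwarz on the `k` selected coordinates, which are distinct because `e` is injective. -/
theorem sum_abs_sub_blockVec_le (he : Function.Injective e) (ω : Fin k → Fin N)
    (s : Fin k → Bool) (t : EuclideanSpace ℝ (Fin d)) :
    ∑ b, |t (e (b, ω b)) - if s b then a else 0| ≤ √k * ‖t - blockVec a e ω s‖ := by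
  have h1 (b : Fin k) : t (e (b, ω b)) - (if s b then a else 0) =
      (t - blockVec a e ω s) (e (b, ω b)) := by
    rw [PiLp.sub_apply, blockVec_apply_self he]
  have hinj : Function.Injective fun b => e (b, ω b) := fun b b' h =>
    congrArg Prod.fst (he h)
  simp_rw [h1]
  set x := t - blockVec a e ω s
  refine abs_le_of_sq_le_sq' ?_ (by positivity) |>.2
  calc (∑ b, |x (e (b, ω b))|) ^ 2 ≤ k * ∑ b, |x (e (b, ω b))| ^ 2 := by
        simpa using sq_sum_le_card_mul_sum_sq (s := Finset.univ) (f := fun b => |x (e (b, ω b))|)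
    _ ≤ k * ∑ i, |x i| ^ 2 := by
        gcongr
        rw [← Finset.sum_image (f := fun i => |x i| ^ 2) fun b _ b' _ h => hinj h]
        exact Finset.sum_le_sum_of_subset_of_nonneg (Finset.subset_univ _) fun i _ _ => sq_nonneg _
    _ = (√k * ‖x‖) ^ 2 := by
        rw [mul_pow, Real.sq_sqrt (by positivity), EuclideanSpace.norm_sq_eq]
        simp

/-- Estimating the blocks costs at least the overlap of the laws with the block on and off. -/
theorem sum_min_le_sum_mul_norm (he : Function.Injective e)
    {L : (Fin k → Fin N) → (Fin k → Bool) → ℝ} (hL : ∀ ω s, 0 ≤ L ω s)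
    (t : EuclideanSpace ℝ (Fin d)) :
    a * ∑ b, ∑ ω, ∑ s, min (L ω (Function.update s b false)) (L ω (Function.update s b true)) ≤
      2 * (√k * ∑ ω, ∑ s, L ω s * ‖t - blockVec a e ω s‖) := by
  -- This is Assouad's two-point argument, at a fixed output `t`: one coordinate cannot be close to
  -- both `0` and `a`. The factor `2` arises because the sum over `s` counts each off/on pair twice.
  calc _ ≤ ∑ b, ∑ ω, 2 * ∑ s, L ω s * |t (e (b, ω b)) - if s b then a else 0| := by
        simp_rw [Finset.mul_sum (a := a)]
        refine Finset.sum_le_sum fun b _ => Finset.sum_le_sum fun ω _ => ?_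
        rw [← sum_update_bool b]
        refine Finset.sum_le_sum fun s _ => ?_
        simp only [Function.update_self, Bool.false_eq_true, if_false, if_true]
        set x := t (e (b, ω b))
        set m := min (L ω (Function.update s b false)) (L ω (Function.update s b true)) with hm
        have hm0 : 0 ≤ m := le_min (hL _ _) (hL _ _)
        have h1 : a ≤ |x - 0| + |x - a| := by
          rw [sub_zero]
          linarith [le_abs_self x, neg_abs_le (x - a)]
        have h2 : m * |x - 0| ≤ L ω (Function.update s b false) * |x - 0| :=
          mul_le_mul_of_nonneg_right (min_le_left _ _) (abs_nonneg _)
        have h3 : m * |x - a| ≤ L ω (Function.update s b true) * |x - a| :=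
          mul_le_mul_of_nonneg_right (min_le_right _ _) (abs_nonneg _)
        have h4 := mul_le_mul_of_nonneg_left h1 hm0
        linarith
    _ = 2 * ∑ ω, ∑ s, L ω s * ∑ b, |t (e (b, ω b)) - if s b then a else 0| := by
        simp_rw [← Finset.mul_sum]
        congr 1
        rw [Finset.sum_comm]
        refine Finset.sum_congr rfl fun ω _ => ?_
        rw [Finset.sum_comm]
        simp_rw [Finset.mul_sum]
    _ ≤ _ := by
        refine mul_le_mul_of_nonneg_left ?_ (by norm_num)
        simp_rw [Finset.mul_sum (a := √(k : ℝ))]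
        refine Finset.sum_le_sum fun ω _ => Finset.sum_le_sum fun s _ => ?_
        have := mul_le_mul_of_nonneg_left (sum_abs_sub_blockVec_le (a := a) he ω s t) (hL ω s)
        linarith

end blockVec

/-! ### Risk against relative entropy for block-sparse vectors -/

/-- The error of the estimator is not integrable a priori; the finite risk bound supplies
integrability and so allows the passage from extended to real integrals. -/
theorem integral_le_of_lintegral_le {α : Type*} [MeasurableSpace α] {μ : Measure α} {F G : α → ℝ}
    {B : ℝ} (hB : 0 ≤ B) (hF : Measurable F) (hF0 : ∀ x, 0 ≤ F x)
    (hFB : ∫⁻ x, ENNReal.ofReal (F x) ∂μ ≤ ENNReal.ofReal B) (hG : Integrable G μ)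
    (hGF : ∀ x, G x ≤ F x) : ∫ x, G x ∂μ ≤ B := by
  have hFi : Integrable F μ := by
    refine ⟨hF.aestronglyMeasurable, ?_⟩
    rw [hasFiniteIntegral_iff_ofReal (Filter.Eventually.of_forall hF0)]
    exact hFB.trans_lt ENNReal.ofReal_lt_top
  refine (integral_mono hG hFi hGF).trans ?_
  rw [integral_eq_lintegral_of_nonneg_ae (Filter.Eventually.of_forall hF0)
    hF.aestronglyMeasurable]
  exact ENNReal.toReal_le_of_le_ofReal hB hFB

namespace SeqAlgorithm

theorem integral_fst_stepLaw {V Θ : Type*} [MeasurableSpace V] [MeasurableSpace Θ] {n : ℕ}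
    (A : SeqAlgorithm.{u} V Θ n) (v₀ : V) (m : ℕ) {G : Hist A.Msg m → ℝ} (hG : Measurable G) :
    ∫ p, G p.1 ∂(A.stepLaw v₀ m) = ∫ h, G h ∂(A.baseLaw v₀ m) := by
  conv_rhs => rw [← Measure.fst_compProd (A.baseLaw v₀ m) (A.msgKernel m v₀), Measure.fst]
  rw [integral_map measurable_fst.aemeasurable hG.aestronglyMeasurable, stepLaw]

section Risk

variable {V : Type*} [MeasurableSpace V] [MeasurableSingletonClass V] {n d : ℕ}
  {ι : Type*} [Fintype ι] {A : SeqAlgorithm.{u} V (EuclideanSpace ℝ (Fin d)) n} {v₀ : V}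
  {v : ι → V} {ε : ℝ} {q : ∀ m, ι → Hist A.Msg m × A.Msg m → ℝ} {w : ι → ℝ}

/-- All data laws are transferred to one reference law of history and output, so that risks for
different vectors can be compared pointwise. -/
theorem IsMsgDensity.risk_eq (hq : A.IsMsgDensity v₀ v ε q) (hw : w ∈ stdSimplex ℝ ι)
    (θ : EuclideanSpace ℝ (Fin d)) : A.risk θ (weightedLaw v w) =
      ∫⁻ x, ENNReal.ofReal (lik q w n x.1 * ‖x.2 - θ‖) ∂(A.baseLaw v₀ n ⊗ₘ A.est) := by
  have hn : Measurable fun t : EuclideanSpace ℝ (Fin d) => ‖t - θ‖ₑ := by fun_prop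
  have hκ : Measurable fun h => ∫⁻ t, ‖t - θ‖ₑ ∂(A.est h) := hn.lintegral_kernel
  have hL : Measurable fun h => ENNReal.ofReal (lik q w n h) :=
    (hq.measurable_lik w n).ennreal_ofReal
  have hL' : Measurable fun x : Hist A.Msg n × EuclideanSpace ℝ (Fin d) =>
      ENNReal.ofReal (lik q w n x.1 * ‖x.2 - θ‖) :=
    (((hq.measurable_lik w n).comp measurable_fst).mul (by fun_prop)).ennreal_ofReal
  unfold risk output
  simp_rw [Kernel.lintegral_comp _ _ _ hn]
  rw [← Measure.lintegral_bind (A.transcript n).measurable.aemeasurable hκ.aemeasurable]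
  change ∫⁻ h, ∫⁻ t, ‖t - θ‖ₑ ∂(A.est h) ∂(A.iidLaw (weightedLaw v w) n) = _
  rw [hq.iidLaw_eq hw n le_rfl, lintegral_withDensity_eq_lintegral_mul _ hL hκ,
    Measure.lintegral_compProd hL']
  refine lintegral_congr fun h => ?_
  rw [Pi.mul_apply, ← lintegral_const_mul _ hn]
  refine lintegral_congr fun t => ?_
  rw [ENNReal.ofReal_mul (hq.lik_pos hw n h).le, ofReal_norm]

end Risk

variable {n d k N : ℕ} {a ε ν : ℝ} {e : Fin k × Fin N → Fin d}
  {A : SeqAlgorithm.{u} (EuclideanSpace ℝ (Fin d) × ℝ) (EuclideanSpace ℝ (Fin d)) n}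
  {v₀ : EuclideanSpace ℝ (Fin d) × ℝ} {q : ∀ m, SignData d → Hist A.Msg m × A.Msg m → ℝ}

/-- The weights of the data under a block-sparse regression vector. -/
def blockWeight (a : ℝ) (e : Fin k × Fin N → Fin d) (ω : Fin k → Fin N) (s : Fin k → Bool) :
    SignData d → ℝ :=
  signWeight fun j => blockVec a e ω s j

theorem blockWeight_mem_stdSimplex (ha : 0 ≤ a) (hka : k * a ≤ 1) (ω : Fin k → Fin N)
    (s : Fin k → Bool) : blockWeight a e ω s ∈ stdSimplex ℝ (SignData d) :=
  signWeight_mem_stdSimplex ((sum_abs_blockVec_le ha ω s).trans hka)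

/-- The information in one message, summed over blocks. Decoupling gives a factor `2` and Bessel
gives `4 * a ^ 2 * ε ^ 2`, uniformly in the history; the remaining likelihoods integrate to one,
leaving the number `N ^ k * 2 ^ k` of pairs `(ω, s)`. -/
theorem IsMsgDensity.sum_integral_le (hq : A.IsMsgDensity v₀ signPoint ε q) (ha : 0 ≤ a)
    (hka : k * a ≤ 1) (he : Function.Injective e) {m : ℕ} (hm : m < n) :
    N * ∑ b, ∑ ω, ∑ s : Fin k → Bool, ∫ p,
        lik q (blockWeight a e ω (Function.update s b false)) m p.1 *
          (mixDensity q (blockWeight a e ω (Function.update s b false)) m p -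
            mixDensity q (blockWeight a e ω (Function.update s b true)) m p) ^ 2
        ∂(A.stepLaw v₀ m) ≤ 8 * a ^ 2 * ε ^ 2 * (N ^ k * 2 ^ k) := by
  have hw (ω : Fin k → Fin N) (s : Fin k → Bool) := blockWeight_mem_stdSimplex (e := e) ha hka ω s
  have hint (b : Fin k) (ω : Fin k → Fin N) (s : Fin k → Bool) :=
    hq.integrable_lik_mul_sq (hw ω (Function.update s b false)) (hw ω (Function.update s b true)) m
  have hL1 (ω : Fin k → Fin N) (s : Fin k → Bool) :
      ∫ p, lik q (blockWeight a e ω s) m p.1 ∂(A.stepLaw v₀ m) = 1 := by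
    rw [A.integral_fst_stepLaw v₀ m (hq.measurable_lik _ m), hq.integral_lik (hw ω s) m hm.le]
  have hLi (ω : Fin k → Fin N) (s : Fin k → Bool) :
      Integrable (fun p => lik q (blockWeight a e ω s) m p.1) (A.stepLaw v₀ m) :=
    Integrable.of_integral_ne_zero (by rw [hL1]; exact one_ne_zero)
  have hpoint (p : Hist A.Msg m × A.Msg m) :
      N * ∑ b, ∑ ω, ∑ s, lik q (blockWeight a e ω (Function.update s b false)) m p.1 *
          (mixDensity q (blockWeight a e ω (Function.update s b false)) m p -
            mixDensity q (blockWeight a e ω (Function.update s b true)) m p) ^ 2 ≤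
        ∑ ω, ∑ s, 8 * a ^ 2 * ε ^ 2 * lik q (blockWeight a e ω s) m p.1 := by
    have hdiff (b : Fin k) (ω : Fin k → Fin N) (s : Fin k → Bool) :
        (mixDensity q (blockWeight a e ω (Function.update s b false)) m p -
            mixDensity q (blockWeight a e ω (Function.update s b true)) m p) ^ 2 =
          a ^ 2 * msgCorr q m (e (b, ω b)) p ^ 2 := by
      rw [blockWeight, blockWeight, mixDensity_signWeight_sub]
      simp_rw [blockVec_update_sub]
      simp [mul_pow]
    simp_rw [hdiff]
    -- Decoupling is applied at a fixed history and message, where the correlations do not depend on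
    -- `ω` or `s` except through the position `e (b, ω b)`.
    have h1 := sum_update_mul_le (L := fun ω s => lik q (blockWeight a e ω s) m p.1)
      (C := fun b j => a ^ 2 * msgCorr q m (e (b, j)) p ^ 2)
      (fun ω s => (hq.lik_pos (hw ω s) m p.1).le)
      (fun ω s b j => by simp only [blockWeight, blockVec_update_update])
      (fun b j => by positivity)
    refine h1.trans ?_
    have h2 : ∑ b, ∑ j, a ^ 2 * msgCorr q m (e (b, j)) p ^ 2 ≤ a ^ 2 * (4 * ε ^ 2) := by
      rw [← Fintype.sum_prod_type' fun b j => a ^ 2 * msgCorr q m (e (b, j)) p ^ 2,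
        ← Finset.mul_sum]
      refine mul_le_mul_of_nonneg_left (le_trans ?_ (hq.sum_msgCorr_sq_le m p)) (sq_nonneg a)
      rw [← Finset.sum_image (f := fun i => msgCorr q m i p ^ 2) fun x _ y _ h => he h]
      exact Finset.sum_le_sum_of_subset_of_nonneg (Finset.subset_univ _) fun i _ _ => sq_nonneg _
    have h3 : 0 ≤ ∑ ω, ∑ s, lik q (blockWeight a e ω s) m p.1 :=
      Finset.sum_nonneg fun ω _ => Finset.sum_nonneg fun s _ => (hq.lik_pos (hw ω s) m p.1).le
    have h4 : ∑ ω, ∑ s, 8 * a ^ 2 * ε ^ 2 * lik q (blockWeight a e ω s) m p.1 =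
        8 * a ^ 2 * ε ^ 2 * ∑ ω, ∑ s, lik q (blockWeight a e ω s) m p.1 := by
      simp_rw [Finset.mul_sum]
    rw [h4]
    linarith [mul_le_mul_of_nonneg_left h2 h3]
  have hint1 : Integrable (fun p => ∑ b, ∑ ω, ∑ s : Fin k → Bool,
      lik q (blockWeight a e ω (Function.update s b false)) m p.1 *
        (mixDensity q (blockWeight a e ω (Function.update s b false)) m p -
          mixDensity q (blockWeight a e ω (Function.update s b true)) m p) ^ 2)
      (A.stepLaw v₀ m) :=
    integrable_finsetSum _ fun b _ => integrable_finsetSum _ fun ω _ =>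
      integrable_finsetSum _ fun s _ => hint b ω s
  have hint2 (ω : Fin k → Fin N) (s : Fin k → Bool) := (hLi ω s).const_mul (8 * a ^ 2 * ε ^ 2)
  have hmono := integral_mono (hint1.const_mul (N : ℝ))
    (integrable_finsetSum _ fun ω _ => integrable_finsetSum _ fun s _ => hint2 ω s) hpoint
  rw [integral_const_mul, integral_finsetSum _ fun ω _ => integrable_finsetSum _ fun s _ =>
    hint2 ω s, integral_finsetSum _ fun b _ => integrable_finsetSum _ fun ω _ =>
      integrable_finsetSum _ fun s _ => hint b ω s] at hmono
  simp_rw [integral_finsetSum _ fun ω _ => integrable_finsetSum _ fun s _ => hint _ ω s,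
    integral_finsetSum _ fun s _ => hint _ _ s, integral_finsetSum _ fun s _ => hint2 _ s,
    integral_const_mul, hL1] at hmono
  refine hmono.trans (le_of_eq ?_)
  simp
  ring

theorem IsMsgDensity.sum_histKL_le (hq : A.IsMsgDensity v₀ signPoint ε q) (ha : 0 ≤ a)
    (hka : k * a ≤ 1) (he : Function.Injective e) :
    N * ∑ b, ∑ ω, ∑ s : Fin k → Bool,
        histKL v₀ q (blockWeight a e ω (Function.update s b false))
          (blockWeight a e ω (Function.update s b true)) n ≤
      n * (24 * a ^ 2 * ε ^ 2 * (N ^ k * 2 ^ k)) := by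
  have hw (ω : Fin k → Fin N) (s : Fin k → Bool) := blockWeight_mem_stdSimplex (e := e) ha hka ω s
  calc _ ≤ N * ∑ b, ∑ ω, ∑ s : Fin k → Bool, 3 * ∑ m ∈ Finset.range n, ∫ p,
        lik q (blockWeight a e ω (Function.update s b false)) m p.1 *
          (mixDensity q (blockWeight a e ω (Function.update s b false)) m p -
            mixDensity q (blockWeight a e ω (Function.update s b true)) m p) ^ 2
        ∂(A.stepLaw v₀ m) := by
        gcongr with b _ ω _ s _
        exact hq.histKL_le (hw _ _) (hw _ _) n le_rfl
    _ = 3 * ∑ m ∈ Finset.range n, N * ∑ b, ∑ ω, ∑ s : Fin k → Bool, ∫ p,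
        lik q (blockWeight a e ω (Function.update s b false)) m p.1 *
          (mixDensity q (blockWeight a e ω (Function.update s b false)) m p -
            mixDensity q (blockWeight a e ω (Function.update s b true)) m p) ^ 2
        ∂(A.stepLaw v₀ m) := by
        simp_rw [← Finset.mul_sum]
        rw [mul_left_comm]
        congr 2
        simp_rw [Finset.sum_comm (t := Finset.range n)]
    _ ≤ 3 * ∑ m ∈ Finset.range n, 8 * a ^ 2 * ε ^ 2 * ((N : ℝ) ^ k * 2 ^ k) := by
        refine mul_le_mul_of_nonneg_left (Finset.sum_le_sum fun m hm => ?_) (by norm_num)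
        exact hq.sum_integral_le ha hka he (Finset.mem_range.1 hm)
    _ = _ := by
        simp
        ring

/-- The integrated form of `sum_min_le_sum_mul_norm`, with each overlap replaced by the lower bound
of `affine_klFun_le_min`. -/
theorem IsMsgDensity.le_sum_histKL (hq : A.IsMsgDensity v₀ signPoint ε q) (ha : 0 ≤ a)
    (hka : k * a ≤ 1) (he : Function.Injective e) (hν : 0 ≤ ν)
    (hrisk : ∀ p ∈ sparseRegressionClass k d 2, A.risk p.1 p.2 ≤ ENNReal.ofReal ν) :
    a * ∑ b, ∑ ω, ∑ s : Fin k → Bool,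
        (3 / 4 - histKL v₀ q (blockWeight a e ω (Function.update s b false))
          (blockWeight a e ω (Function.update s b true)) n) ≤
      2 * (√k * (N ^ k * 2 ^ k * ν)) := by
  have hw (ω : Fin k → Fin N) (s : Fin k → Bool) := blockWeight_mem_stdSimplex (e := e) ha hka ω s
  have hrisk' (ω : Fin k → Fin N) (s : Fin k → Bool) :
      ∫⁻ x, ENNReal.ofReal (lik q (blockWeight a e ω s) n x.1 * ‖x.2 - blockVec a e ω s‖)
        ∂(A.baseLaw v₀ n ⊗ₘ A.est) ≤ ENNReal.ofReal ν := by
    rw [← hq.risk_eq (hw ω s)]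
    exact hrisk _ (signPoint_mem_sparseRegressionClass ((sum_abs_blockVec_le ha ω s).trans hka)
      (ncard_blockVec_le ω s))
  set F : Hist A.Msg n × EuclideanSpace ℝ (Fin d) → ℝ := fun x =>
    2 * (√k * ∑ ω, ∑ s, lik q (blockWeight a e ω s) n x.1 * ‖x.2 - blockVec a e ω s‖) with hF
  set g : Fin k → (Fin k → Fin N) → (Fin k → Bool) → Hist A.Msg n → ℝ := fun b ω s h =>
    3 / 8 * (lik q (blockWeight a e ω (Function.update s b false)) n h +
      lik q (blockWeight a e ω (Function.update s b true)) n h) -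
    (lik q (blockWeight a e ω (Function.update s b true)) n h -
      lik q (blockWeight a e ω (Function.update s b false)) n h +
      lik q (blockWeight a e ω (Function.update s b false)) n h *
        Real.log (lik q (blockWeight a e ω (Function.update s b false)) n h /
          lik q (blockWeight a e ω (Function.update s b true)) n h)) with hg
  have hmeas (ω : Fin k → Fin N) (s : Fin k → Bool) :
      Measurable fun x : Hist A.Msg n × EuclideanSpace ℝ (Fin d) =>
        lik q (blockWeight a e ω s) n x.1 * ‖x.2 - blockVec a e ω s‖ :=
    ((hq.measurable_lik _ n).comp measurable_fst).mul (by fun_prop)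
  have hnonneg (ω : Fin k → Fin N) (s : Fin k → Bool)
      (x : Hist A.Msg n × EuclideanSpace ℝ (Fin d)) :
      0 ≤ lik q (blockWeight a e ω s) n x.1 * ‖x.2 - blockVec a e ω s‖ :=
    mul_nonneg (hq.lik_pos (hw ω s) n x.1).le (norm_nonneg _)
  have hFm : Measurable F := by
    refine Measurable.const_mul (Measurable.const_mul ?_ _) _
    exact Finset.measurable_sum _ fun ω _ => Finset.measurable_sum _ fun s _ => hmeas ω s
  have hF0 (x) : 0 ≤ F x := by
    refine mul_nonneg (by norm_num) (mul_nonneg (Real.sqrt_nonneg _) ?_)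
    exact Finset.sum_nonneg fun ω _ => Finset.sum_nonneg fun s _ => hnonneg ω s x
  have hFB : ∫⁻ x, ENNReal.ofReal (F x) ∂(A.baseLaw v₀ n ⊗ₘ A.est) ≤
      ENNReal.ofReal (2 * (√k * (N ^ k * 2 ^ k * ν))) := by
    have h1 (x : Hist A.Msg n × EuclideanSpace ℝ (Fin d)) : ENNReal.ofReal (F x) =
        ENNReal.ofReal (2 * √k) * ∑ ω, ∑ s, ENNReal.ofReal
          (lik q (blockWeight a e ω s) n x.1 * ‖x.2 - blockVec a e ω s‖) := by
      change ENNReal.ofReal (2 * (√k * _)) = _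
      rw [← mul_assoc, ENNReal.ofReal_mul (by positivity), ENNReal.ofReal_sum_of_nonneg
        fun ω _ => Finset.sum_nonneg fun s _ => hnonneg ω s x]
      congr 1
      exact Finset.sum_congr rfl fun ω _ =>
        ENNReal.ofReal_sum_of_nonneg fun s _ => hnonneg ω s x
    simp_rw [h1]
    have hm1 (ω : Fin k → Fin N) (s : Fin k → Bool) := (hmeas ω s).ennreal_ofReal
    rw [lintegral_const_mul _ (Finset.measurable_sum _ fun ω _ => Finset.measurable_sum _
      fun s _ => hm1 ω s), lintegral_finsetSum _ fun ω _ => Finset.measurable_sum _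
      fun s _ => hm1 ω s]
    simp_rw [lintegral_finsetSum _ fun s _ => hm1 _ s]
    calc _ ≤ ENNReal.ofReal (2 * √k) * ∑ _ω : Fin k → Fin N, ∑ _s : Fin k → Bool,
          ENNReal.ofReal ν := by
          gcongr with ω _ s _
          exact hrisk' ω s
      _ = _ := by
          rw [← mul_assoc, ENNReal.ofReal_mul (by positivity : (0 : ℝ) ≤ 2 * √k),
            ENNReal.ofReal_mul (by positivity : (0 : ℝ) ≤ N ^ k * 2 ^ k),
            ENNReal.ofReal_mul (by positivity : (0 : ℝ) ≤ N ^ k), ENNReal.ofReal_pow (by positivity),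
            ENNReal.ofReal_pow (by positivity)]
          simp [mul_assoc]
  have hli (w : SignData d → ℝ) (hw : w ∈ stdSimplex ℝ (SignData d)) := hq.integrable_lik hw n
  have hgi (b : Fin k) (ω : Fin k → Fin N) (s : Fin k → Bool) :
      Integrable (g b ω s) (A.baseLaw v₀ n) :=
    (((hli _ (hw _ _)).add (hli _ (hw _ _))).const_mul _).sub
      (((hli _ (hw _ _)).sub (hli _ (hw _ _))).add (hq.integrable_mul_log (hw _ _) (hw _ _) n))
  have hgv (b : Fin k) (ω : Fin k → Fin N) (s : Fin k → Bool) :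
      ∫ h, g b ω s h ∂(A.baseLaw v₀ n) =
        3 / 4 - histKL v₀ q (blockWeight a e ω (Function.update s b false))
          (blockWeight a e ω (Function.update s b true)) n := by
    have i1 := hli _ (hw ω (Function.update s b false))
    have i2 := hli _ (hw ω (Function.update s b true))
    have i3 := hq.integrable_mul_log (hw ω (Function.update s b false))
      (hw ω (Function.update s b true)) n
    rw [hg]
    dsimp only
    -- Both likelihoods have integral one: the linear difference vanishes and `3/8 * (1 + 1)` yields
    -- `3/4`.
    rw [integral_sub (by exact (i1.add i2).const_mul _) (by exact (i2.sub i1).add i3),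
      integral_const_mul, integral_add i1 i2, integral_add (by exact i2.sub i1) i3,
      integral_sub i2 i1, hq.integral_lik (hw _ _) n le_rfl, hq.integral_lik (hw _ _) n le_rfl,
      histKL]
    ring
  set G : Hist A.Msg n → ℝ := fun h => a * ∑ b, ∑ ω, ∑ s, g b ω s h with hG
  have hGi : Integrable G (A.baseLaw v₀ n) :=
    (integrable_finsetSum _ fun b _ => integrable_finsetSum _ fun ω _ =>
      integrable_finsetSum _ fun s _ => hgi b ω s).const_mul a
  have hGv : ∫ h, G h ∂(A.baseLaw v₀ n) = a * ∑ b, ∑ ω, ∑ s : Fin k → Bool,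
        (3 / 4 - histKL v₀ q (blockWeight a e ω (Function.update s b false))
          (blockWeight a e ω (Function.update s b true)) n) := by
    rw [hG, integral_const_mul, integral_finsetSum _ fun b _ => integrable_finsetSum _ fun ω _ =>
      integrable_finsetSum _ fun s _ => hgi b ω s]
    simp_rw [integral_finsetSum _ fun ω _ => integrable_finsetSum _ fun s _ => hgi _ ω s,
      integral_finsetSum _ fun s _ => hgi _ _ s, hgv]
  have hfst : (A.baseLaw v₀ n ⊗ₘ A.est).map Prod.fst = A.baseLaw v₀ n :=
    Measure.fst_compProd _ _
  have hGi' : Integrable (fun x : Hist A.Msg n × EuclideanSpace ℝ (Fin d) => G x.1)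
      (A.baseLaw v₀ n ⊗ₘ A.est) := by
    rw [← hfst] at hGi
    exact hGi.comp_measurable measurable_fst
  have hGv' : ∫ x, G x.1 ∂(A.baseLaw v₀ n ⊗ₘ A.est) = ∫ h, G h ∂(A.baseLaw v₀ n) := by
    conv_rhs => rw [← hfst]
    rw [integral_map measurable_fst.aemeasurable]
    rw [hfst]
    exact hGi.aestronglyMeasurable
  rw [← hGv, ← hGv']
  refine integral_le_of_lintegral_le (by positivity) hFm hF0 hFB hGi' fun x => ?_
  refine le_trans ?_ (sum_min_le_sum_mul_norm he
    (fun ω s => (hq.lik_pos (hw ω s) n x.1).le) x.2)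
  refine mul_le_mul_of_nonneg_left ?_ ha
  refine Finset.sum_le_sum fun b _ => Finset.sum_le_sum fun ω _ => Finset.sum_le_sum fun s _ => ?_
  exact affine_klFun_le_min (hq.lik_pos (hw _ _) n x.1) (hq.lik_pos (hw _ _) n x.1)

/-! ### The sample size bound and the theorem -/

/-- The sample size needed to estimate sparse regression vectors up to `ν`. -/
theorem IsLDP.sample_size_ge (hA : A.IsLDP (dataUniverse d) ε) (hk : 1 ≤ k) (hkd : k ≤ d)
    (hε : 0 < ε) (hε1 : ε ≤ 1) (hν : 0 < ν) (hνk : ν ≤ 1 / (4 * √(2 * k)))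
    (hrisk : ∀ p ∈ sparseRegressionClass k d 2, A.risk p.1 p.2 ≤ ENNReal.ofReal ν) :
    1 / 3072 * (d * k / (ν ^ 2 * ε ^ 2)) ≤ n := by
  have hk0 : (0 : ℝ) < k := by exact_mod_cast hk
  have hsk : 0 < √(k : ℝ) := Real.sqrt_pos.2 hk0
  have hsq : √(k : ℝ) * √k = k := Real.mul_self_sqrt hk0.le
  obtain ⟨q, hq⟩ := hA.exists_isMsgDensity hε hε1
    (signPoint_mem_dataUniverse ((fun _ => false, false) : SignData d))
    (v := signPoint) signPoint_mem_dataUniverse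
  set N := d / k with hN
  have hN1 : 1 ≤ N := (Nat.one_le_div_iff (by omega)).2 hkd
  have hkN : k * N ≤ d := Nat.mul_div_le d k
  -- Rounding `d / k` down loses at most a factor two, since `k ≤ d`.
  have hdN : d ≤ 2 * (k * N) := by
    have h1 : d < k * N + k := by
      have h2 := Nat.mod_lt d (show k > 0 by omega)
      have h3 := Nat.div_add_mod d k
      rw [← hN] at h3
      omega
    nlinarith
  set e : Fin k × Fin N → Fin d := fun x => Fin.castLE hkN (finProdFinEquiv x)
  have he : Function.Injective e :=
    (Fin.castLE_injective hkN).comp finProdFinEquiv.injective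
  -- This makes the Assouad bound `2 * √k * ν / a` equal to `k / 2`, below the main term `3 * k /
  -- 4`, so that entropy `k / 4` is forced.
  set a := 4 * ν / √k with ha_def
  have ha : 0 < a := by positivity
  have hask : a * √k = 4 * ν := by rw [ha_def]; field_simp
  -- The upper limit on `ν` is used here, to keep the vectors in the `ℓ₁` ball.
  have hka : k * a ≤ 1 := by
    have h2 : √(k : ℝ) ≤ √(2 * k) := Real.sqrt_le_sqrt (by linarith)
    have h1 : ν * (4 * √(2 * k)) ≤ 1 := by
      rwa [le_div_iff₀ (by positivity)] at hνk
    calc k * a = √k * (a * √k) := by linear_combination (-a) * hsq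
      _ = ν * (4 * √k) := by rw [hask]; ring
      _ ≤ ν * (4 * √(2 * k)) := by gcongr
      _ ≤ 1 := h1
  have hup := hq.sum_histKL_le ha.le hka he
  have hlow := hq.le_sum_histKL ha.le hka he hν.le hrisk
  set K := ∑ b, ∑ ω, ∑ s : Fin k → Bool,
        histKL (signPoint (fun _ => false, false)) q
          (blockWeight a e ω (Function.update s b false))
          (blockWeight a e ω (Function.update s b true)) n
  have hsum : ∑ b, ∑ ω, ∑ s : Fin k → Bool,
        (3 / 4 - histKL (signPoint (fun _ => false, false)) q
          (blockWeight a e ω (Function.update s b false))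
          (blockWeight a e ω (Function.update s b true)) n) =
      k * (N ^ k * 2 ^ k) * (3 / 4) - K := by
    simp_rw [Finset.sum_sub_distrib]
    simp
    ring
  rw [hsum] at hlow
  have hN0 : (0 : ℝ) < N := by exact_mod_cast hN1
  set M : ℝ := N ^ k * 2 ^ k with hM
  have hM0 : 0 < M := by positivity
  have h1 : 2 * (√k * (M * ν)) = a * (k * M * (1 / 2)) := by
    have : ν = a * √k / 4 := by rw [hask]; ring
    rw [this]
    linear_combination (a * M / 2) * hsq
  rw [h1] at hlow
  have h2 : k * M * (1 / 4) ≤ K := by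
    have := le_of_mul_le_mul_left hlow ha
    linarith
  have h3 : N * (k * M * (1 / 4)) ≤ n * (24 * a ^ 2 * ε ^ 2 * M) :=
    (mul_le_mul_of_nonneg_left h2 hN0.le).trans hup
  have h4 : k * N ≤ n * (96 * a ^ 2 * ε ^ 2) := by
    refine le_of_mul_le_mul_right ?_ hM0
    linarith
  have h5 : a ^ 2 * k = 16 * ν ^ 2 := by
    calc a ^ 2 * k = (a * √k) ^ 2 := by rw [mul_pow, sq √(k : ℝ), hsq]
      _ = _ := by rw [hask]; ring
  -- The constant is `3072 = 2 * 96 * 16`: the rounding in `hdN`, the comparison `h4`, and `a ^ 2 *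
  -- k = 16 * ν ^ 2`.
  have h6 : (d : ℝ) ≤ 2 * (k * N) := by exact_mod_cast hdN
  have h7 : (d : ℝ) * k ≤ n * (3072 * (ν ^ 2 * ε ^ 2)) := by
    calc (d : ℝ) * k ≤ 2 * (n * (96 * a ^ 2 * ε ^ 2)) * k := by gcongr; linarith
      _ = n * (192 * ε ^ 2 * (a ^ 2 * k)) := by ring
      _ = _ := by rw [h5]; ring
  rw [div_mul_div_comm, one_mul, div_le_iff₀ (by positivity)]
  exact h7

end SeqAlgorithm

end

theorem mainTheorem3 :
    ∃ c : ℝ, 0 < c ∧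
      ∀ (k d n : ℕ) (ε : ℝ), 1 ≤ k → k ≤ d → 0 < ε → ε ≤ 1 →
      ∀ A : SeqAlgorithm.{u} (EuclideanSpace ℝ (Fin d) × ℝ) (EuclideanSpace ℝ (Fin d)) n,
        A.IsLDP (dataUniverse d) ε →
        (∀ ν : ℝ, 0 < ν → ν ≤ 1 / (4 * √(2 * k)) →
          (∀ q ∈ sparseRegressionClass k d 2, A.risk q.1 q.2 ≤ ENNReal.ofReal ν) →
          c * (d * k / (ν ^ 2 * ε ^ 2)) ≤ n) ∧
        (1 ≤ n → ∃ q ∈ sparseRegressionClass k d 2,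
          ENNReal.ofReal (min (c * √(d * k / (n * ε ^ 2))) (1 / (4 * √(2 * k))))
            ≤ A.risk q.1 q.2) := by
  refine ⟨1 / 3072, by norm_num, fun k d n ε hk hkd hε hε1 A hA =>
    ⟨fun ν hν hνk hrisk => hA.sample_size_ge hk hkd hε hε1 hν hνk hrisk, fun hn => ?_⟩⟩
  have hk0 : (0 : ℝ) < k := by exact_mod_cast hk
  have hd0 : (0 : ℝ) < d := by exact_mod_cast hk.trans hkd
  have hn0 : (0 : ℝ) < n := by exact_mod_cast hn
  set r : ℝ := d * k / (n * ε ^ 2) with hr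
  have hr0 : 0 < r := by positivity
  set ν := min (1 / 3072 * √r) (1 / (4 * √(2 * k))) with hν_def
  have hν : 0 < ν := lt_min (by positivity) (by positivity)
  -- If every risk were below `ν`, the first part would give `d * k ≤ 3072 * n * ν ^ 2 * ε ^ 2`.
  -- Since `ν ≤ √r / 3072`, the right side is at most `d * k / 3072`, a contradiction.
  by_contra! hcon
  have h1 := hA.sample_size_ge hk hkd hε hε1 hν (min_le_right _ _) fun q hq => (hcon q hq).le
  have h2 : ν ^ 2 ≤ (1 / 3072) ^ 2 * r := by
    calc ν ^ 2 ≤ (1 / 3072 * √r) ^ 2 := by gcongr; exact min_le_left _ _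
      _ = _ := by rw [mul_pow, Real.sq_sqrt hr0.le]
  have h3 : r * (n * ε ^ 2) = d * k := by rw [hr]; field_simp
  rw [div_mul_div_comm, one_mul, div_le_iff₀ (by positivity), ← h3] at h1
  have h4 : n * (3072 * (ν ^ 2 * ε ^ 2)) ≤ n * (3072 * ((1 / 3072) ^ 2 * r * ε ^ 2)) := by gcongr
  have h5 : 0 < r * (n * ε ^ 2) := by positivity
  nlinarith
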